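/- Let $\delta\ge 1$, $\eta,\mu,k_4>0$ with $\delta\ge\eta\mu$, and let $k_1,k_2,k_3:\mathbb R\to(0,\infty)$ be Lipschitz continuous and strictly increasing. For $s\ge 0$ consider, on the state space $\mathbb R_{\ge0}^3$, the system $$\dot u_1=-k_1(u_2)u_1-\delta k_3(u_3)u_2u_1^\delta+\eta k_4u_2+s,\qquad \dot u_2=\mu k_3(u_3)u_2u_1^\delta-k_4u_2,\qquad \dot u_3=-k_2(u_2)u_3 .$$ Put $U_1=\big(k_4/(\mu k_3(0))\big)^{1/\delta}$ and consider the equation $$0=-k_1(v)U_1-\tfrac{k_4}{\mu}(\delta-\eta\mu)v+s.\qquad(*)$$ If $\delta=\eta\mu$, assume in addition that $(*)$ has a solution $v\in\mathbb R$ for every $s\ge k_1(0)U_1$. Write $u_e^1=(s/k_1(0),0,0)$ and $\lambda(s)=\mu k_3(0)(s/k_1(0))^\delta-k_4$. Asymptotic stability and instability are meant in the sense of Lyapunov. Then: 1. The value $s=k_1(0)U_1$ is a bifurcation point: arbitrarily close to it there are values $s\ge0$ for which the system on $\mathbb R_{\ge0}^3$ is not topologically equivalent to the system at $s=k_1(0)U_1$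 (no homeomorphism of $\mathbb R_{\ge0}^3$ takes forward orbits onto forward orbits). 2. If $0\le s\le k_1(0)U_1$, then $u_e^1$ is the only equilibrium in $\mathbb R_{\ge0}^3$. If $s>k_1(0)U_1$, then $(*)$ has exactly one real solution $u_2^*$, it is positive, and there are exactly two equilibria in $\mathbb R_{\ge0}^3$, namely $u_e^1$ and $u_e^2=(U_1,u_2^*,0)$. 3. If $0\le s<k_1(0)U_1$, then $\lambda(s)<0$ and $u_e^1$ is asymptotically stable with respect to initial data in $\mathbb R_{\ge 0}^3$, and for $s>0$ also with respect to all initial data in $\mathbb R^3$. If $s>k_1(0)U_1$, then $\lambda(s)>0$ and $u_e^1$ is unstable, already with respect to initial data in $\mathbb R_{\ge0}^3$. If $k_1$ is differentiable at $0$, the right-hand side is differentiable at $u_e^1$ with Jacobian $$\begin{bmatrix}-k_1(0)&-\frac{k_1'(0)}{k_1(0)}s-\delta k_3(0)\big(\frac{s}{k_1(0)}\big)^\delta+\eta k_4&0\\0&\lambda(s)&0\\0&0&-k_2(0)\end{bmatrix},$$ whose eigenvalues, with multiplicity, are $-k_1(0),\lambda(s),-k_2(0)$. 4. If $s>k_1(0)U_1$,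 then $u_e^2$ is asymptotically stable, both with respect to initial data in $\mathbb R_{\ge0}^3$ and with respect to all initial data in $\mathbb R^3$. If moreover $k_1$ is differentiable at $u_2^*$ and $k_3$ at $0$, the right-hand side is differentiable at $u_e^2$ with Jacobian $$\begin{bmatrix}A_1&A_2&-\frac\delta\mu\frac{k_3'(0)}{k_3(0)}k_4u_2^*\\A_3&0&\frac{k_3'(0)}{k_3(0)}k_4u_2^*\\0&0&-k_2(u_2^*)\end{bmatrix},\qquad \begin{aligned}A_1&=-k_1(u_2^*)-\delta^2k_3(0)u_2^*U_1^{\delta-1},\\A_2&=-k_1'(u_2^*)U_1-\tfrac{k_4}\mu(\delta-\eta\mu),\\A_3&=\delta\mu k_3(0)u_2^*U_1^{\delta-1},\end{aligned}$$ whose eigenvalues, with multiplicity, are $-k_2(u_2^*)$ and $\frac{A_1}2\pm\sqrt{\frac{A_1^2}4+A_2A_3}$; all of them have negative real part if $\delta>\eta\mu$ or $k_1'(u_2^*)\ne0$. 5. For every $s\ge0$ exactly one equilibrium in $\mathbb R_{\ge0}^3$ is Lyapunov stable with respect to initial data in $\mathbb R_{\ge0}^3$. -/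

import Mathlib

open Set Filter Topology

noncomputable section

/-! ### Autonomous differential equations on a state space

The state space is a subset `S` of `ℝⁿ`, realised as `Fin n → ℝ`. All notions below depend on the
metric only through the topology, so the choice of norm on `ℝⁿ` is immaterial. -/

/-- `u` is a classical solution of `u' = f(u)` on the time interval `I`, with values in `S`. -/
def IsSolutionOn {n : ℕ} (f : (Fin n → ℝ) → (Fin n → ℝ)) (S : Set (Fin n → ℝ)) (I : Set ℝ)
    (u : ℝ → (Fin n → ℝ)) : Prop :=
  ∀ t ∈ I, u t ∈ S ∧ HasDerivWithinAt u (f (u t)) I t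

/-- The equilibrium points of `u' = f(u)` in `S`. -/
def equilibria {n : ℕ} (f : (Fin n → ℝ) → (Fin n → ℝ)) (S : Set (Fin n → ℝ)) :
    Set (Fin n → ℝ) :=
  {e | e ∈ S ∧ f e = 0}

/-- Lyapunov stability of `e` relative to the state space `S`: for initial data in `S` close to
`e`, a solution in `S` exists for all times, and all solutions stay close to `e`. -/
def LyapunovStable {n : ℕ} (f : (Fin n → ℝ) → (Fin n → ℝ)) (S : Set (Fin n → ℝ))
    (e : Fin n → ℝ) : Prop :=
  ∀ ε > 0, ∃ r > 0, ∀ x ∈ S, dist x e < r →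
    (∃ u, IsSolutionOn f S (Ici 0) u ∧ u 0 = x) ∧
    ∀ T ≥ 0, ∀ u, IsSolutionOn f S (Icc 0 T) u → u 0 = x → ∀ t ∈ Icc 0 T, dist (u t) e < ε

/-- Asymptotic stability of `e` relative to `S`: Lyapunov stability, and all solutions that start
close enough to `e` converge to `e`. -/
def AsymptoticallyStable {n : ℕ} (f : (Fin n → ℝ) → (Fin n → ℝ)) (S : Set (Fin n → ℝ))
    (e : Fin n → ℝ) : Prop :=
  LyapunovStable f S e ∧
  ∃ r > 0, ∀ u, IsSolutionOn f S (Ici 0) u → dist (u 0) e < r → Tendsto u atTop (𝓝 e)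

/-- Instability of `e` relative to `S`: arbitrarily close to `e` there start solutions in `S` that
reach a fixed distance from `e`. (Instability relative to `S` implies instability relative to every
larger state space.) -/
def Unstable {n : ℕ} (f : (Fin n → ℝ) → (Fin n → ℝ)) (S : Set (Fin n → ℝ))
    (e : Fin n → ℝ) : Prop :=
  ∃ ε > 0, ∀ r > 0, ∃ T ≥ 0, ∃ u, IsSolutionOn f S (Icc 0 T) u ∧ dist (u 0) e < r ∧
    ε ≤ dist (u T) e

/-- The set of states that are reached, forwards in time, from the state `x`. -/
def positiveOrbit {n : ℕ} (f : (Fin n → ℝ) → (Fin n → ℝ)) (S : Set (Fin n → ℝ))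
    (x : Fin n → ℝ) : Set (Fin n → ℝ) :=
  {y | ∃ T ≥ 0, ∃ u, IsSolutionOn f S (Icc 0 T) u ∧ u 0 = x ∧ u T = y}

/-- Topological equivalence of `u' = f(u)` and `u' = g(u)` on `S`: a homeomorphism of `S` takes
the (forward) orbits of `f` onto the (forward) orbits of `g`. -/
def TopologicallyEquivalent {n : ℕ} (f g : (Fin n → ℝ) → (Fin n → ℝ))
    (S : Set (Fin n → ℝ)) : Prop :=
  ∃ h : S ≃ₜ S, ∀ x y : S, (y : Fin n → ℝ) ∈ positiveOrbit f S x ↔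
    (h y : Fin n → ℝ) ∈ positiveOrbit g S (h x)

/-- `s₀` is a bifurcation point of the family `u' = F s u` on `S`, with parameter `s` in `A`:
arbitrarily close to `s₀` there are parameters in `A` at which the system is not topologically
equivalent to the one at `s₀`. -/
def IsBifurcationPoint {n : ℕ} (F : ℝ → (Fin n → ℝ) → (Fin n → ℝ)) (S : Set (Fin n → ℝ))
    (A : Set ℝ) (s₀ : ℝ) : Prop :=
  s₀ ∈ A ∧ ∃ᶠ s in 𝓝[A] s₀, ¬ TopologicallyEquivalent (F s) (F s₀) S

/-- The Jacobian matrix of `f` at `x` (meaningful where `f` is differentiable). -/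
def jacobian {n : ℕ} (f : (Fin n → ℝ) → (Fin n → ℝ)) (x : Fin n → ℝ) :
    Matrix (Fin n) (Fin n) ℝ :=
  LinearMap.toMatrix' (fderiv ℝ f x : (Fin n → ℝ) →ₗ[ℝ] (Fin n → ℝ))

/-- The complex eigenvalues of a real matrix, with algebraic multiplicity. -/
def complexEigenvalues {n : ℕ} (M : Matrix (Fin n) (Fin n) ℝ) : Multiset ℂ :=
  (M.map (algebraMap ℝ ℂ)).charpoly.roots

/-- The nonnegative octant. -/
def octant : Set (Fin 3 → ℝ) := {u | ∀ i, 0 ≤ u i}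

/-! ### The soil model -/

/-- The parameters and constitutive functions of the model. -/
structure SoilModel where
  δ : ℝ
  η : ℝ
  μ : ℝ
  k₄ : ℝ
  k₁ : ℝ → ℝ
  k₂ : ℝ → ℝ
  k₃ : ℝ → ℝ

namespace SoilModel

/-- The right-hand side of the reduced system for
`(u₁, u₂, u₃)` = (organic matter, microbes, charcoal), with source `s`. -/
def field (P : SoilModel) (s : ℝ) (u : Fin 3 → ℝ) : Fin 3 → ℝ :=
  ![-P.k₁ (u 1) * u 0 - P.δ * P.k₃ (u 2) * u 1 * u 0 ^ P.δ + P.η * P.k₄ * u 1 + s,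
    P.μ * P.k₃ (u 2) * u 1 * u 0 ^ P.δ - P.k₄ * u 1,
    -P.k₂ (u 1) * u 2]

def U₁ (P : SoilModel) : ℝ := (P.k₄ / (P.μ * P.k₃ 0)) ^ (1 / P.δ)

/-- The critical value `k₁(0) U₁` of the source. -/
def threshold (P : SoilModel) : ℝ := P.k₁ 0 * P.U₁

/-- The scalar equation for the second component `v` of an equilibrium `(U₁, v, 0)`. -/
def MicrobeEq (P : SoilModel) (s v : ℝ) : Prop :=
  0 = -P.k₁ v * P.U₁ - P.k₄ / P.μ * (P.δ - P.η * P.μ) * v + s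

/-- The standing assumptions. The last one is only needed in the balanced case `δ = ημ`; for
`δ > ημ` the equation is always solvable. -/
structure Admissible (P : SoilModel) : Prop where
  one_le_δ : 1 ≤ P.δ
  η_pos : 0 < P.η
  μ_pos : 0 < P.μ
  ημ_le_δ : P.η * P.μ ≤ P.δ
  k₄_pos : 0 < P.k₄
  k₁_pos : ∀ x, 0 < P.k₁ x
  k₂_pos : ∀ x, 0 < P.k₂ x
  k₃_pos : ∀ x, 0 < P.k₃ x
  k₁_lipschitz : ∃ K, LipschitzWith K P.k₁
  k₂_lipschitz : ∃ K, LipschitzWith K P.k₂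
  k₃_lipschitz : ∃ K, LipschitzWith K P.k₃
  k₁_strictMono : StrictMono P.k₁
  k₂_strictMono : StrictMono P.k₂
  k₃_strictMono : StrictMono P.k₃
  solvable : P.δ = P.η * P.μ → ∀ s, P.threshold ≤ s → ∃ v, P.MicrobeEq s v

/-- The equilibrium without microbes. -/
def e₁ (P : SoilModel) (s : ℝ) : Fin 3 → ℝ := ![s / P.k₁ 0, 0, 0]

/-- The equilibrium with microbe concentration `v`. -/
def e₂ (P : SoilModel) (v : ℝ) : Fin 3 → ℝ := ![P.U₁, v, 0]

/-- The eigenvalue of the linearization at `e₁` that changes sign. -/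
def criticalEigenvalue (P : SoilModel) (s : ℝ) : ℝ :=
  P.μ * P.k₃ 0 * (s / P.k₁ 0) ^ P.δ - P.k₄

def A₁ (P : SoilModel) (v : ℝ) : ℝ := -P.k₁ v - P.δ ^ 2 * P.k₃ 0 * v * P.U₁ ^ (P.δ - 1)

def A₂ (P : SoilModel) (v : ℝ) : ℝ :=
  -deriv P.k₁ v * P.U₁ - P.k₄ / P.μ * (P.δ - P.η * P.μ)

def A₃ (P : SoilModel) (v : ℝ) : ℝ := P.δ * P.μ * P.k₃ 0 * v * P.U₁ ^ (P.δ - 1)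

/-- The principal complex square root of `A₁² / 4 + A₂ A₃`. -/
def sqrtDiscr (P : SoilModel) (v : ℝ) : ℂ :=
  ((P.A₁ v ^ 2 / 4 + P.A₂ v * P.A₃ v : ℝ) : ℂ) ^ (1 / 2 : ℂ)

end SoilModel

end

/-!
On the octant the field is quasi-positive and a weighted total mass grows at most linearly in time,
so solutions exist for all times. At a nonnegative equilibrium `u₃ = 0`, and either `u₂ = 0` or
`u₁ = U₁`; in the latter case `u₂` is a zero of a strictly decreasing function whose sign at `0` is
that of `s - k₁(0) U₁`. A homeomorphism that matches forward orbits preserves equilibria, these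
being the points whose forward orbit is a singleton; their number jumps from one to two at the
threshold, which is therefore a bifurcation point.

The charcoal `u₃` always decays exponentially. Below the threshold so do the microbes near `e₁`, and
`u₁ - s / k₁(0)` follows; above it the microbes grow. At the threshold the linearization at `e₁` is
degenerate, but the growth rate of the microbes is bounded by an exponentially decaying function of
time, so the microbes stay bounded by a multiple of their initial size. Near `e₂` the system without
charcoal has a Lyapunov function of the form `φ(u₁) + ψ(u₂)`, whose derivative along solutions
vanishes on the whole line `u₁ = U₁`. A small multiple of the product `(u₁ - U₁) (u₂ - u₂*)`
compensates for this, and the charcoal enters as an exponentially decaying perturbation.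
-/

noncomputable section

/-! ### Differential inequalities -/

section DifferentialInequalities

theorem antitoneOn_Icc_of_hasDerivWithinAt_nonpos {φ φ' : ℝ → ℝ} {a b : ℝ}
    (h : ∀ t ∈ Icc a b, HasDerivWithinAt φ (φ' t) (Icc a b) t) (h' : ∀ t ∈ Ioo a b, φ' t ≤ 0) :
    AntitoneOn φ (Icc a b) := by
  refine antitoneOn_of_hasDerivWithinAt_nonpos (convex_Icc a b)
    (fun t ht => (h t ht).continuousWithinAt) (f' := φ') ?_ ?_
  · exact fun t ht => (h t (interior_subset ht)).mono interior_subset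
  · rwa [interior_Icc]

theorem hasDerivWithinAt_Ici_of_Icc {E : Type*} [NormedAddCommGroup E] [NormedSpace ℝ E]
    {φ : ℝ → E} {φ' : E} {a b t : ℝ} (h : HasDerivWithinAt φ φ' (Icc a b) t)
    (ht : t ∈ Ico a b) : HasDerivWithinAt φ φ' (Ici t) t :=
  h.mono_of_mem_nhdsWithin (Icc_mem_nhdsGE_of_mem ht)

theorem le_of_hasDerivWithinAt_nonpos_above {φ φ' : ℝ → ℝ} {T c : ℝ}
    (h : ∀ t ∈ Icc 0 T, HasDerivWithinAt φ (φ' t) (Icc 0 T) t)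
    (h' : ∀ t ∈ Icc 0 T, c < φ t → φ' t ≤ 0) (h0 : φ 0 ≤ c) :
    ∀ t ∈ Icc 0 T, φ t ≤ c := by
  intro t ht
  have hbarrier : ∀ ε > 0, φ t ≤ c + ε * (1 + t) := by
    intro ε hε
    refine image_le_of_deriv_right_lt_deriv_boundary (B := fun t => c + ε * (1 + t))
      (B' := fun _ => ε * 1) (fun t ht => (h t ht).continuousWithinAt)
      (fun t ht => hasDerivWithinAt_Ici_of_Icc (h t (Ico_subset_Icc_self ht)) ht) (by linarith)
      (fun t => (((hasDerivAt_id t).const_add 1).const_mul ε).const_add c) ?_ ht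
    intro t ht heq
    have hpos : 0 < ε * (1 + t) := mul_pos hε (by linarith [ht.1])
    linarith [h' t (Ico_subset_Icc_self ht) (by linarith)]
  have hlim : Tendsto (fun ε : ℝ => c + ε * (1 + t)) (𝓝[>] 0) (𝓝 (c + 0 * (1 + t))) :=
    tendsto_const_nhds.add ((tendsto_id.mono_left nhdsWithin_le_nhds).mul_const _)
  rw [zero_mul, add_zero] at hlim
  exact ge_of_tendsto hlim (eventually_mem_of_tendsto_nhdsWithin tendsto_id |>.mono hbarrier)

theorem le_mul_exp_of_hasDerivWithinAt_le_above {φ φ' Ψ ψ : ℝ → ℝ} {T a : ℝ}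
    (h : ∀ t ∈ Icc 0 T, HasDerivWithinAt φ (φ' t) (Icc 0 T) t)
    (hΨ : ∀ t ∈ Icc 0 T, HasDerivWithinAt Ψ (ψ t) (Icc 0 T) t) (h0 : φ 0 ≤ a * Real.exp (Ψ 0))
    (h' : ∀ t ∈ Icc 0 T, a * Real.exp (Ψ t) < φ t → φ' t ≤ ψ t * φ t) :
    ∀ t ∈ Icc 0 T, φ t ≤ a * Real.exp (Ψ t) := by
  intro t ht
  have hderiv : ∀ t ∈ Icc 0 T, HasDerivWithinAt (fun t => φ t / Real.exp (Ψ t))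
      ((φ' t - ψ t * φ t) / Real.exp (Ψ t)) (Icc 0 T) t := fun t ht =>
    ((h t ht).fun_div (hΨ t ht).exp (Real.exp_pos _).ne').congr_deriv (by field_simp)
  refine (div_le_iff₀ (Real.exp_pos _)).1 (le_of_hasDerivWithinAt_nonpos_above hderiv
    (fun t ht hlt => ?_) ((div_le_iff₀ (Real.exp_pos _)).2 h0) t ht)
  exact div_nonpos_of_nonpos_of_nonneg
    (sub_nonpos.2 (h' t ht ((lt_div_iff₀ (Real.exp_pos _)).1 hlt))) (Real.exp_pos _).le

theorem le_mul_exp_mul_of_hasDerivWithinAt_le_above {φ φ' : ℝ → ℝ} {T c a : ℝ}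
    (h : ∀ t ∈ Icc 0 T, HasDerivWithinAt φ (φ' t) (Icc 0 T) t) (h0 : φ 0 ≤ a)
    (hle : ∀ t ∈ Icc 0 T, a * Real.exp (c * t) < φ t → φ' t ≤ c * φ t) :
    ∀ t ∈ Icc 0 T, φ t ≤ a * Real.exp (c * t) :=
  le_mul_exp_of_hasDerivWithinAt_le_above h (ψ := fun _ => c)
    (fun t _ => ((hasDerivWithinAt_id t _).const_mul c).congr_deriv (mul_one c))
    (by rwa [mul_zero, Real.exp_zero, mul_one]) hle

/-- The bound without absolute values applies to `φ` and to `-φ`, since the forcing term is absorbed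
by the damping wherever `φ` exceeds the claimed bound. -/
theorem abs_le_mul_exp_of_abs_add_le {φ φ' : ℝ → ℝ} {T α B c : ℝ} (hc : c < α)
    (h : ∀ t ∈ Icc 0 T, HasDerivWithinAt φ (φ' t) (Icc 0 T) t)
    (h' : ∀ t ∈ Icc 0 T, |φ' t + α * φ t| ≤ B * Real.exp (-c * t)) :
    ∀ t ∈ Icc 0 T, |φ t| ≤ (|φ 0| + B / (α - c)) * Real.exp (-c * t) := by
  have habsorb : ∀ t ∈ Icc 0 T, ∀ x y : ℝ, |y + α * x| ≤ B * Real.exp (-c * t) →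
      (|φ 0| + B / (α - c)) * Real.exp (-c * t) < x → y ≤ -c * x := by
    intro t _ x y hy hx
    have hforce : B * Real.exp (-c * t) ≤ (α - c) * x := by
      rw [← div_le_iff₀' (sub_pos.2 hc), mul_div_right_comm]
      refine le_trans ?_ hx.le
      gcongr
      exact le_add_of_nonneg_left (abs_nonneg _)
    linarith [(abs_le.1 hy).2]
  intro t ht
  have hB : 0 ≤ B / (α - c) := by
    refine div_nonneg ?_ (sub_pos.2 hc).le
    exact nonneg_of_mul_nonneg_left ((abs_nonneg _).trans (h' t ht)) (Real.exp_pos _)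
  have h0 := le_add_of_nonneg_right (a := |φ 0|) hB
  refine abs_le'.2 ⟨le_mul_exp_mul_of_hasDerivWithinAt_le_above h ((le_abs_self _).trans h0)
    (fun t ht => habsorb t ht _ _ (h' t ht)) t ht, ?_⟩
  refine le_mul_exp_mul_of_hasDerivWithinAt_le_above (fun t ht => (h t ht).fun_neg)
    ((neg_le_abs _).trans h0) (fun t ht => habsorb t ht _ _ ?_) t ht
  rw [mul_neg, ← neg_add, abs_neg]
  exact h' t ht

theorem abs_le_mul_exp_of_hasDerivWithinAt_mul {φ ψ : ℝ → ℝ} {T c : ℝ}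
    (h : ∀ t ∈ Icc 0 T, HasDerivWithinAt φ (ψ t * φ t) (Icc 0 T) t)
    (hψ : ∀ t ∈ Icc 0 T, ψ t ≤ c) :
    ∀ t ∈ Icc 0 T, |φ t| ≤ |φ 0| * Real.exp (c * t) := by
  intro t ht
  have hsq := le_mul_exp_mul_of_hasDerivWithinAt_le_above (c := 2 * c)
    (fun t ht => (h t ht).fun_pow 2) le_rfl (fun t ht _ => ?_) t ht
  · refine abs_le_of_sq_le_sq (hsq.trans_eq ?_) (by positivity)
    rw [mul_pow, sq_abs, ← Real.exp_nat_mul, Nat.cast_ofNat, mul_assoc]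
  · calc ((2 : ℕ) : ℝ) * φ t ^ (2 - 1) * (ψ t * φ t) = 2 * ψ t * φ t ^ 2 := by norm_num; ring
      _ ≤ 2 * c * φ t ^ 2 := by gcongr; exact hψ t ht

theorem forall_lt_of_bootstrap {φ : ℝ → ℝ} {T c : ℝ} (hφ : ContinuousOn φ (Icc 0 T))
    (h0 : φ 0 < c) (hstep : ∀ t ∈ Icc 0 T, (∀ σ ∈ Icc 0 t, φ σ ≤ c) → φ t < c) :
    ∀ t ∈ Icc 0 T, φ t < c := by
  intro t ht
  by_contra! hct
  have hcont : ContinuousOn φ (Icc 0 t) := hφ.mono (Icc_subset_Icc_right ht.2)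
  have hcompact : IsCompact (Icc 0 t ∩ φ ⁻¹' {c}) :=
    isCompact_Icc.of_isClosed_subset
      (hcont.preimage_isClosed_of_isClosed isClosed_Icc isClosed_singleton) inter_subset_left
  have hne : (Icc 0 t ∩ φ ⁻¹' {c}).Nonempty := intermediate_value_Icc ht.1 hcont ⟨h0.le, hct⟩
  obtain ⟨τ, ⟨hτ, hφτ⟩, hleast⟩ := hcompact.exists_isLeast hne
  refine (hstep τ ⟨hτ.1, hτ.2.trans ht.2⟩ fun σ hσ => ?_).ne hφτ
  by_contra! hcσ
  have hσt : Icc 0 σ ⊆ Icc 0 t := Icc_subset_Icc_right (hσ.2.trans hτ.2)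
  obtain ⟨ρ, hρ, hφρ⟩ := intermediate_value_Icc hσ.1 (hcont.mono hσt) ⟨h0.le, hcσ.le⟩
  have hτσ : τ = σ := le_antisymm ((hleast ⟨hσt hρ, hφρ⟩).trans hρ.2) hσ.2
  exact hcσ.ne' (hτσ ▸ hφτ)

end DifferentialInequalities

/-! ### Solutions of autonomous differential equations -/

section Solutions

variable {n : ℕ} {f g : (Fin n → ℝ) → (Fin n → ℝ)} {S : Set (Fin n → ℝ)} {I J : Set ℝ}
  {u w : ℝ → Fin n → ℝ} {x : Fin n → ℝ}

namespace IsSolutionOn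

theorem mono (h : IsSolutionOn f S I u) (hJ : J ⊆ I) : IsSolutionOn f S J u :=
  fun t ht => ⟨(h t (hJ ht)).1, (h t (hJ ht)).2.mono hJ⟩

theorem univ (h : IsSolutionOn f S I u) : IsSolutionOn f Set.univ I u :=
  fun t ht => ⟨mem_univ _, (h t ht).2⟩

theorem of_mapsTo (h : IsSolutionOn f Set.univ I u) (hu : MapsTo u I S) : IsSolutionOn f S I u :=
  fun t ht => ⟨hu ht, (h t ht).2⟩

theorem congr_field (h : IsSolutionOn f S I u) (hfg : ∀ t ∈ I, f (u t) = g (u t)) :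
    IsSolutionOn g S I u :=
  fun t ht => ⟨(h t ht).1, hfg t ht ▸ (h t ht).2⟩

theorem continuousOn (h : IsSolutionOn f S I u) : ContinuousOn u I :=
  fun t ht => (h t ht).2.continuousWithinAt

theorem hasDerivWithinAt_apply (h : IsSolutionOn f S I u) {t : ℝ} (ht : t ∈ I) (i : Fin n) :
    HasDerivWithinAt (fun t => u t i) (f (u t) i) I t :=
  hasDerivWithinAt_pi.1 (h t ht).2 i

theorem comp_const_add (h : IsSolutionOn f S (Ici 0) u) {a : ℝ} (ha : 0 ≤ a) :
    IsSolutionOn f S (Ici 0) (fun t => u (a + t)) := by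
  intro t ht
  have hmaps : MapsTo (a + ·) (Ici (0 : ℝ)) (Ici 0) := fun t ht => add_nonneg ha ht
  refine ⟨(h _ (hmaps ht)).1, ?_⟩
  exact ((h _ (hmaps ht)).2.scomp t ((hasDerivWithinAt_id t _).const_add a) hmaps).congr_deriv
    (one_smul ℝ _)

theorem eqOn (hf : LocallyLipschitz f) {T : ℝ} (hu : IsSolutionOn f S (Icc 0 T) u)
    (hw : IsSolutionOn f S (Icc 0 T) w) (h0 : u 0 = w 0) : EqOn u w (Icc 0 T) := by
  have hcompact : IsCompact (u '' Icc 0 T ∪ w '' Icc 0 T) :=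
    (isCompact_Icc.image_of_continuousOn hu.continuousOn).union
      (isCompact_Icc.image_of_continuousOn hw.continuousOn)
  obtain ⟨K, hK⟩ := hf.locallyLipschitzOn.exists_lipschitzOnWith_of_compact hcompact
  exact ODE_solution_unique_of_mem_Icc_right (v := fun _ => f)
    (s := fun _ => u '' Icc 0 T ∪ w '' Icc 0 T) (fun _ _ => hK)
    hu.continuousOn
    (fun t ht => hasDerivWithinAt_Ici_of_Icc (hu t (Ico_subset_Icc_self ht)).2 ht)
    (fun t ht => Or.inl (mem_image_of_mem u (Ico_subset_Icc_self ht)))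
    hw.continuousOn
    (fun t ht => hasDerivWithinAt_Ici_of_Icc (hw t (Ico_subset_Icc_self ht)).2 ht)
    (fun t ht => Or.inr (mem_image_of_mem w (Ico_subset_Icc_self ht))) h0

end IsSolutionOn

theorem exists_isSolutionOn_Ici_of_forall_Icc (hf : LocallyLipschitz f)
    (h : ∀ T : ℝ, 0 ≤ T → ∃ u, IsSolutionOn f S (Icc 0 T) u ∧ u 0 = x) :
    ∃ u, IsSolutionOn f S (Ici 0) u ∧ u 0 = x := by
  choose U hU hU0 using fun m : ℕ => h m m.cast_nonneg
  have hfloor : ∀ N : ℕ, ∀ t ∈ Ico (0 : ℝ) N, U (⌊t⌋₊ + 1) t = U N t := by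
    intro N t ht
    have hle : ((⌊t⌋₊ + 1 : ℕ) : ℝ) ≤ N := Nat.cast_le.2 ((Nat.floor_lt ht.1).2 ht.2)
    refine (hU _).eqOn hf ((hU N).mono (Icc_subset_Icc_right hle)) (by rw [hU0, hU0]) ⟨ht.1, ?_⟩
    exact_mod_cast (Nat.lt_floor_add_one t).le
  refine ⟨fun t => U (⌊t⌋₊ + 1) t, fun t ht => ?_, hU0 _⟩
  obtain ⟨N, hN⟩ := exists_nat_gt t
  have hnhds : Ico 0 (N : ℝ) ∈ 𝓝[Ici 0] t := by
    rw [← Ici_inter_Iio]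
    exact inter_mem_nhdsWithin _ (Iio_mem_nhds hN)
  have hsol := hU N t ⟨ht, hN.le⟩
  have heq := hfloor N t ⟨ht, hN⟩
  beta_reduce
  rw [heq]
  exact ⟨hsol.1, (hsol.2.mono_of_mem_nhdsWithin (mem_of_superset hnhds Ico_subset_Icc_self))
    |>.congr_of_eventuallyEq (eventually_of_mem hnhds (hfloor N)) heq⟩

theorem exists_isSolutionOn_of_lipschitzWith {K : NNReal} (hf : LipschitzWith K f) {M : ℝ}
    (hM : ∀ u, ‖f u‖ ≤ M) (x : Fin n → ℝ) : ∃ u, IsSolutionOn f univ (Ici 0) u ∧ u 0 = x := by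
  refine exists_isSolutionOn_Ici_of_forall_Icc hf.locallyLipschitz fun T hT => ?_
  have hpl : IsPicardLindelof (fun _ => f) (tmin := 0) (tmax := T) ⟨0, le_rfl, hT⟩ x
      (M.toNNReal * T.toNNReal) 0 M.toNNReal K := by
    refine IsPicardLindelof.of_time_independent
      (fun u _ => (hM u).trans (Real.le_coe_toNNReal M)) hf.lipschitzOnWith ?_
    simp only [NNReal.coe_mul, Real.coe_toNNReal T hT, sub_zero, max_eq_left hT, NNReal.coe_zero,
      sub_self, le_refl]
  obtain ⟨u, hu0, hu⟩ := hpl.exists_eq_forall_mem_Icc_hasDerivWithinAt₀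
  exact ⟨u, fun t ht => ⟨mem_univ _, hu t ht⟩, hu0⟩

theorem lipschitzWith_map_coordinates {K : NNReal} {φ : ℝ → ℝ} (hφ : LipschitzWith K φ) :
    LipschitzWith K (fun (u : Fin n → ℝ) i => φ (u i)) :=
  LipschitzWith.of_dist_le_mul fun u w => (dist_pi_le_iff (by positivity)).2 fun i =>
    (hφ.dist_le_mul _ _).trans (by gcongr; exact dist_le_pi_dist u w i)

/-- The coordinatewise projection onto the cube `[-R, R]ⁿ`, which truncates a field without
changing it on the closed ball of radius `R`. -/
def clamp (R : ℝ) (u : Fin n → ℝ) : Fin n → ℝ := fun i => max (-R) (min R (u i))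

theorem clamp_mem_closedBall {R : ℝ} (hR : 0 ≤ R) (u : Fin n → ℝ) :
    clamp R u ∈ Metric.closedBall 0 R :=
  mem_closedBall_zero_iff.2 <| (pi_norm_le_iff_of_nonneg hR).2 fun _ =>
    abs_le.2 ⟨le_max_left _ _, max_le (by linarith) (min_le_left _ _)⟩

theorem clamp_of_norm_le {R : ℝ} {u : Fin n → ℝ} (hu : ‖u‖ ≤ R) : clamp R u = u := by
  ext i
  have hi := abs_le.1 ((norm_le_pi_norm u i).trans hu)
  rw [clamp, min_eq_right hi.2, max_eq_right hi.1]

theorem lipschitzWith_clamp (R : ℝ) : LipschitzWith 1 (clamp R : (Fin n → ℝ) → Fin n → ℝ) :=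
  lipschitzWith_map_coordinates ((LipschitzWith.id.const_min R).const_max (-R))

theorem exists_isSolutionOn_comp_clamp (hf : LocallyLipschitz f) {R : ℝ} (hR : 0 ≤ R)
    (x : Fin n → ℝ) : ∃ u, IsSolutionOn (f ∘ clamp R) univ (Ici 0) u ∧ u 0 = x := by
  have hcompact : IsCompact (Metric.closedBall (0 : Fin n → ℝ) R) := isCompact_closedBall 0 R
  obtain ⟨K, hK⟩ := hf.locallyLipschitzOn.exists_lipschitzOnWith_of_compact hcompact
  obtain ⟨M, hM⟩ := hcompact.exists_bound_of_continuousOn hf.continuous.continuousOn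
  have hlip : LipschitzWith (K * 1) (f ∘ clamp R) := lipschitzOnWith_univ.1 <|
    hK.comp (lipschitzWith_clamp R).lipschitzOnWith fun u _ => clamp_mem_closedBall hR u
  exact exists_isSolutionOn_of_lipschitzWith hlip (fun u => hM _ (clamp_mem_closedBall hR u)) x

theorem exists_isSolutionOn_of_apriori_bound (hf : LocallyLipschitz f)
    (hbound : ∀ T ≥ 0, ∃ R, ∀ t ∈ Icc 0 T, ∀ u,
      IsSolutionOn f univ (Icc 0 t) u → u 0 = x → ‖u t‖ ≤ R) :
    ∃ u, IsSolutionOn f univ (Ici 0) u ∧ u 0 = x := by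
  refine exists_isSolutionOn_Ici_of_forall_Icc hf fun T hT => ?_
  obtain ⟨R, hR⟩ := hbound T hT
  set R' := max R ‖x‖ + 1
  have hRR' : R < R' := (le_max_left R ‖x‖).trans_lt (lt_add_one _)
  have hxR' : ‖x‖ < R' := (le_max_right R ‖x‖).trans_lt (lt_add_one _)
  obtain ⟨u, hu, hu0⟩ := exists_isSolutionOn_comp_clamp hf ((norm_nonneg x).trans hxR'.le) x
  have husol : ∀ t, (∀ σ ∈ Icc 0 t, ‖u σ‖ ≤ R') → IsSolutionOn f univ (Icc 0 t) u := fun t ht =>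
    (hu.mono Icc_subset_Ici_self).congr_field fun σ hσ =>
      congrArg f (clamp_of_norm_le (ht σ hσ))
  have hlt : ∀ t ∈ Icc 0 T, ‖u t‖ < R' :=
    forall_lt_of_bootstrap (hu.mono Icc_subset_Ici_self).continuousOn.norm (by rwa [hu0])
      fun t ht hle => (hR t ht u (husol t hle) hu0).trans_lt hRR'
  exact ⟨u, husol T fun t ht => (hlt t ht).le, hu0⟩

/-- Prolonging the field by `f(u⁺)` makes the orthant invariant, so that the a priori bound is only
needed for solutions in the orthant. -/
theorem exists_isSolutionOn_nonneg_of_quasipositive (hf : LocallyLipschitz f)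
    (hquasi : ∀ u, 0 ≤ u → ∀ i, u i = 0 → 0 ≤ f u i) (hx : 0 ≤ x)
    (hbound : ∀ T ≥ 0, ∃ R, ∀ t ∈ Icc 0 T, ∀ u,
      IsSolutionOn f (Ici 0) (Icc 0 t) u → u 0 = x → ‖u t‖ ≤ R) :
    ∃ u, IsSolutionOn f (Ici 0) (Ici 0) u ∧ u 0 = x := by
  set p : (Fin n → ℝ) → Fin n → ℝ := fun u i => max (u i) 0
  have hp0 : ∀ u, 0 ≤ p u := fun u i => le_max_right _ _
  have hpeq : ∀ u, 0 ≤ u → p u = u := fun u hu => funext fun i => max_eq_left (hu i)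
  have hnonneg : ∀ T u, IsSolutionOn (f ∘ p) univ (Icc 0 T) u → u 0 = x →
      ∀ t ∈ Icc 0 T, 0 ≤ u t := by
    intro T u hu hu0 t ht i
    refine neg_nonpos.1 (le_of_hasDerivWithinAt_nonpos_above
      (fun t ht => (hu.hasDerivWithinAt_apply ht i).neg) (fun t _ hneg => ?_) ?_ t ht)
    · exact neg_nonpos.2 (hquasi _ (hp0 _) i (max_eq_right (neg_pos.1 hneg).le))
    · exact neg_nonpos.2 ((hx i).trans_eq (congrFun hu0 i).symm)
  have hsol : ∀ {I : Set ℝ} {u}, IsSolutionOn (f ∘ p) univ I u → (∀ t ∈ I, 0 ≤ u t) →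
      IsSolutionOn f (Ici 0) I u := fun hu hpos =>
    (hu.of_mapsTo fun t ht => hpos t ht).congr_field fun t ht => congrArg f (hpeq _ (hpos t ht))
  have hlip : LocallyLipschitz (f ∘ p) :=
    hf.comp (lipschitzWith_map_coordinates (LipschitzWith.id.max_const 0)).locallyLipschitz
  obtain ⟨u, hu, hu0⟩ := exists_isSolutionOn_of_apriori_bound hlip fun T hT => by
    obtain ⟨R, hR⟩ := hbound T hT
    exact ⟨R, fun t ht u hu hu0 => hR t ht u (hsol hu (hnonneg t u hu hu0)) hu0⟩
  exact ⟨u, hsol hu fun t ht =>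
    hnonneg t u (hu.mono Icc_subset_Ici_self) hu0 t (right_mem_Icc.2 ht), hu0⟩

end Solutions

/-! ### Stability and topological equivalence -/

section Stability

variable {n : ℕ} {f g : (Fin n → ℝ) → (Fin n → ℝ)} {S : Set (Fin n → ℝ)} {e x : Fin n → ℝ} {ρ : ℝ}

/-- Stability of `e` for those solutions that do not leave the closed ball of radius `ρ`. It is what
a local Lyapunov function yields, and it makes no claim about existence of solutions. -/
def StableWithin (f : (Fin n → ℝ) → (Fin n → ℝ)) (S : Set (Fin n → ℝ)) (e : Fin n → ℝ)
    (ρ : ℝ) : Prop :=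
  ∀ ε > 0, ∃ r > 0, ∀ T ≥ 0, ∀ u, IsSolutionOn f S (Icc 0 T) u →
    (∀ t ∈ Icc 0 T, dist (u t) e ≤ ρ) → dist (u 0) e < r → ∀ t ∈ Icc 0 T, dist (u t) e < ε

theorem StableWithin.exists_forall_dist_lt (h : StableWithin f S e ρ) (hρ : 0 < ρ) {ε : ℝ}
    (hε : 0 < ε) : ∃ r > 0, ∀ T ≥ 0, ∀ u, IsSolutionOn f S (Icc 0 T) u → dist (u 0) e < r →
      ∀ t ∈ Icc 0 T, dist (u t) e < ε := by
  have hmin : 0 < min ε ρ := lt_min hε hρ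
  obtain ⟨r, hr, hstable⟩ := h (min ε ρ) hmin
  refine ⟨min r (min ε ρ), lt_min hr hmin, fun T _ u hu h0 t ht => ?_⟩
  refine (forall_lt_of_bootstrap (φ := fun t => dist (u t) e)
    ((continuous_id.dist continuous_const).comp_continuousOn hu.continuousOn)
    (h0.trans_le (min_le_right _ _)) (fun t ht hle => ?_) t ht).trans_le (min_le_left _ _)
  exact hstable t ht.1 u (hu.mono (Icc_subset_Icc_right ht.2))
    (fun σ hσ => (hle σ hσ).trans (min_le_right _ _)) (h0.trans_le (min_le_left _ _)) t
    (right_mem_Icc.2 ht.1)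

theorem StableWithin.lyapunovStable (h : StableWithin f S e ρ) (hρ : 0 < ρ)
    (hex : ∀ x ∈ S, ∃ u, IsSolutionOn f S (Ici 0) u ∧ u 0 = x) : LyapunovStable f S e := by
  intro ε hε
  obtain ⟨r, hr, hstable⟩ := h.exists_forall_dist_lt hρ hε
  exact ⟨r, hr, fun x hx hxr => ⟨hex x hx, fun T hT u hu h0 => hstable T hT u hu (h0 ▸ hxr)⟩⟩

theorem StableWithin.lyapunovStable_univ (h : StableWithin f univ e ρ) (hρ : 0 < ρ)
    (hf : LocallyLipschitz f) : LyapunovStable f univ e := by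
  intro ε hε
  obtain ⟨r, hr, hstable⟩ := h.exists_forall_dist_lt hρ hε
  refine ⟨r, hr, fun x _ hxr => ⟨?_, fun T hT u hu h0 => hstable T hT u hu (h0 ▸ hxr)⟩⟩
  refine exists_isSolutionOn_of_apriori_bound hf fun T _ => ⟨ε + ‖e‖, fun t ht u hu h0 => ?_⟩
  have hdist := hstable t ht.1 u hu (h0 ▸ hxr) t (right_mem_Icc.2 ht.1)
  rw [dist_eq_norm] at hdist
  linarith [norm_le_norm_sub_add (u t) e]

theorem LyapunovStable.asymptoticallyStable (h : LyapunovStable f S e) (hρ : 0 < ρ)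
    (hatt : ∀ u, IsSolutionOn f S (Ici 0) u → (∀ t ≥ 0, dist (u t) e ≤ ρ) →
      ∀ r > 0, ∃ t ≥ 0, dist (u t) e < r) : AsymptoticallyStable f S e := by
  have hstay : ∀ ε > 0, ∃ r > 0, ∀ u, IsSolutionOn f S (Ici 0) u → dist (u 0) e < r →
      ∀ t ≥ 0, dist (u t) e < ε := by
    intro ε hε
    obtain ⟨r, hr, hstable⟩ := h ε hε
    exact ⟨r, hr, fun u hu h0 t ht => (hstable _ (hu 0 self_mem_Ici).1 h0).2 t ht u
      (hu.mono Icc_subset_Ici_self) rfl t (right_mem_Icc.2 ht)⟩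
  obtain ⟨r, hr, hρstay⟩ := hstay ρ hρ
  refine ⟨h, r, hr, fun u hu h0 => Metric.tendsto_atTop.2 fun ε hε => ?_⟩
  obtain ⟨r', hr', hεstay⟩ := hstay ε hε
  obtain ⟨a, ha, har⟩ := hatt u hu (fun t ht => (hρstay u hu h0 t ht).le) r' hr'
  refine ⟨a, fun t hat => ?_⟩
  have hshift := hεstay (fun t => u (a + t)) (hu.comp_const_add ha) (by rwa [add_zero]) (t - a)
    (sub_nonneg.2 hat)
  rwa [add_sub_cancel] at hshift

theorem AsymptoticallyStable.of_univ (h : AsymptoticallyStable f univ e)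
    (hex : ∀ x ∈ S, ∃ u, IsSolutionOn f S (Ici 0) u ∧ u 0 = x) : AsymptoticallyStable f S e := by
  obtain ⟨hstable, r, hr, hatt⟩ := h
  refine ⟨fun ε hε => ?_, r, hr, fun u hu => hatt u hu.univ⟩
  obtain ⟨r, hr, hε⟩ := hstable ε hε
  exact ⟨r, hr, fun x hx hxr =>
    ⟨hex x hx, fun T hT u hu => (hε x (mem_univ _) hxr).2 T hT u hu.univ⟩⟩

theorem Unstable.not_lyapunovStable (h : Unstable f S e) : ¬ LyapunovStable f S e := by
  obtain ⟨ε, hε, hfar⟩ := h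
  intro hstable
  obtain ⟨r, hr, hnear⟩ := hstable ε hε
  obtain ⟨T, hT, u, hu, h0, hle⟩ := hfar r hr
  exact hle.not_gt <|
    (hnear (u 0) (hu 0 (left_mem_Icc.2 hT)).1 h0).2 T hT u hu rfl T (right_mem_Icc.2 hT)

theorem positiveOrbit_eq_singleton (hf : LocallyLipschitz f) (he : e ∈ equilibria f S) :
    positiveOrbit f S e = {e} := by
  have hconst : ∀ T, IsSolutionOn f S (Icc 0 T) (fun _ => e) := fun T t _ =>
    ⟨he.1, by rw [he.2]; exact hasDerivWithinAt_const _ _ _⟩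
  refine Subset.antisymm ?_ (singleton_subset_iff.2 ⟨0, le_rfl, _, hconst 0, rfl, rfl⟩)
  rintro y ⟨T, hT, u, hu, h0, rfl⟩
  exact hu.eqOn hf (hconst T) h0 (right_mem_Icc.2 hT)

theorem mem_equilibria_of_positiveOrbit_subset
    (hex : ∃ u, IsSolutionOn f S (Ici 0) u ∧ u 0 = x) (h : positiveOrbit f S x ⊆ {x}) :
    x ∈ equilibria f S := by
  obtain ⟨u, hu, rfl⟩ := hex
  have hconst : ∀ t ∈ Ici (0 : ℝ), u t = u 0 := fun t ht =>
    h ⟨t, ht, u, hu.mono Icc_subset_Ici_self, rfl, rfl⟩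
  obtain ⟨hmem, hderiv⟩ := hu 0 self_mem_Ici
  have hzero : HasDerivWithinAt u 0 (Ici 0) 0 :=
    (hasDerivWithinAt_const (0 : ℝ) (Ici 0) (u 0)).congr hconst rfl
  exact ⟨hmem, (uniqueDiffOn_Ici (0 : ℝ) 0 self_mem_Ici).eq_deriv _ hderiv hzero⟩

theorem TopologicallyEquivalent.exists_homeomorph_equilibria (h : TopologicallyEquivalent f g S)
    (hf : LocallyLipschitz f) (hg : ∀ x ∈ S, ∃ u, IsSolutionOn g S (Ici 0) u ∧ u 0 = x) :
    ∃ φ : S ≃ₜ S, ∀ e : S, ↑e ∈ equilibria f S → ↑(φ e) ∈ equilibria g S := by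
  obtain ⟨φ, hφ⟩ := h
  refine ⟨φ, fun e he => mem_equilibria_of_positiveOrbit_subset (hg _ (φ e).2) ?_⟩
  rintro _ ⟨T, hT, u, hu, h0, rfl⟩
  obtain ⟨y, hy⟩ := φ.surjective ⟨u T, (hu T (right_mem_Icc.2 hT)).1⟩
  have horbit : (y : Fin n → ℝ) ∈ positiveOrbit f S e := (hφ e y).2 ⟨T, hT, u, hu, h0, by rw [hy]⟩
  rw [positiveOrbit_eq_singleton hf he, mem_singleton_iff, SetCoe.ext_iff] at horbit
  rw [mem_singleton_iff, ← horbit, hy]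

end Stability

/-! ### The soil model on the octant -/

theorem funext_fin_three {α : Type*} {u w : Fin 3 → α} (h0 : u 0 = w 0) (h1 : u 1 = w 1)
    (h2 : u 2 = w 2) : u = w :=
  funext fun | 0 => h0 | 1 => h1 | 2 => h2

namespace SoilModel

variable {P : SoilModel} {s v : ℝ} {u : Fin 3 → ℝ} {S : Set (Fin 3 → ℝ)}

theorem field_zero (P : SoilModel) (s : ℝ) (u : Fin 3 → ℝ) : P.field s u 0 =
    -P.k₁ (u 1) * u 0 - P.δ * P.k₃ (u 2) * u 1 * u 0 ^ P.δ + P.η * P.k₄ * u 1 + s := rfl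

theorem field_one (P : SoilModel) (s : ℝ) (u : Fin 3 → ℝ) : P.field s u 1 =
    P.μ * P.k₃ (u 2) * u 1 * u 0 ^ P.δ - P.k₄ * u 1 := rfl

theorem field_two (P : SoilModel) (s : ℝ) (u : Fin 3 → ℝ) : P.field s u 2 =
    -P.k₂ (u 1) * u 2 := rfl

theorem field_mass (P : SoilModel) (s : ℝ) (u : Fin 3 → ℝ) :
    P.μ * P.field s u 0 + P.δ * P.field s u 1 =
      P.μ * s - P.μ * P.k₁ (u 1) * u 0 - (P.δ - P.η * P.μ) * P.k₄ * u 1 := by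
  rw [field_zero, field_one]; ring

namespace Admissible

theorem δ_pos (hP : P.Admissible) : 0 < P.δ := one_pos.trans_le hP.one_le_δ

theorem continuous_k₁ (hP : P.Admissible) : Continuous P.k₁ :=
  hP.k₁_lipschitz.choose_spec.continuous

theorem continuous_k₂ (hP : P.Admissible) : Continuous P.k₂ :=
  hP.k₂_lipschitz.choose_spec.continuous

theorem continuous_k₃ (hP : P.Admissible) : Continuous P.k₃ :=
  hP.k₃_lipschitz.choose_spec.continuous

theorem locallyLipschitz_field (hP : P.Admissible) (s : ℝ) : LocallyLipschitz (P.field s) := by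
  obtain ⟨K₁, hK₁⟩ := hP.k₁_lipschitz
  obtain ⟨K₂, hK₂⟩ := hP.k₂_lipschitz
  obtain ⟨K₃, hK₃⟩ := hP.k₃_lipschitz
  set rates : (Fin 3 → ℝ) → ℝ × ℝ × ℝ := fun u => (P.k₁ (u 1), P.k₂ (u 1), P.k₃ (u 2))
  set G : (Fin 3 → ℝ) × ℝ × ℝ × ℝ → Fin 3 → ℝ := fun p =>
    ![-p.2.1 * p.1 0 - P.δ * p.2.2.2 * p.1 1 * p.1 0 ^ P.δ + P.η * P.k₄ * p.1 1 + s,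
      P.μ * p.2.2.2 * p.1 1 * p.1 0 ^ P.δ - P.k₄ * p.1 1, -p.2.2.1 * p.1 2]
  have hrates : LipschitzWith _ rates :=
    (hK₁.comp (LipschitzWith.eval 1)).prodMk
      ((hK₂.comp (LipschitzWith.eval 1)).prodMk (hK₃.comp (LipschitzWith.eval 2)))
  have hpow : ContDiff ℝ (1 : ℕ) fun p : (Fin 3 → ℝ) × ℝ × ℝ × ℝ => p.1 0 ^ P.δ :=
    ContDiff.rpow_const_of_le (by fun_prop) (by exact_mod_cast hP.one_le_δ)
  have hG : ContDiff ℝ 1 G := contDiff_pi.2 fun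
    | 0 => by dsimp [G]; fun_prop
    | 1 => by dsimp [G]; fun_prop
    | 2 => by dsimp [G]; fun_prop
  have hfield : P.field s = G ∘ fun u => (u, rates u) := rfl
  rw [hfield]
  exact hG.locallyLipschitz.comp (LipschitzWith.id.prodMk hrates).locallyLipschitz

/-! ### Global existence in the octant -/

theorem field_quasipositive (hP : P.Admissible) (hs : 0 ≤ s) {u : Fin 3 → ℝ} (hu : 0 ≤ u) :
    ∀ i, u i = 0 → 0 ≤ P.field s u i
  | 0, hi => by
    rw [field_zero, hi, Real.zero_rpow hP.δ_pos.ne', mul_zero, mul_zero, sub_zero, zero_add]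
    exact add_nonneg (mul_nonneg (mul_pos hP.η_pos hP.k₄_pos).le (hu 1)) hs
  | 1, hi => by rw [field_one, hi, mul_zero, mul_zero, zero_mul, sub_zero]
  | 2, hi => by rw [field_two, hi, mul_zero]

theorem mass_le (hP : P.Admissible) {u : ℝ → Fin 3 → ℝ} {T : ℝ}
    (hu : IsSolutionOn (P.field s) octant (Icc 0 T) u) :
    ∀ t ∈ Icc 0 T, P.μ * u t 0 + P.δ * u t 1 ≤ P.μ * u 0 0 + P.δ * u 0 1 + P.μ * s * t := by
  intro t ht
  have hmass := le_of_hasDerivWithinAt_nonpos_above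
    (fun t ht => (((hu.hasDerivWithinAt_apply ht 0).const_mul P.μ).fun_add
      ((hu.hasDerivWithinAt_apply ht 1).const_mul P.δ)).fun_sub
        ((hasDerivWithinAt_id t _).const_mul (P.μ * s))) (fun t ht _ => ?_) le_rfl t ht
  · simp only [id, mul_zero, sub_zero] at hmass
    linarith
  · rw [field_mass]
    have hdecay := mul_nonneg (mul_pos hP.μ_pos (hP.k₁_pos (u t 1))).le ((hu t ht).1 0)
    have hloss := mul_nonneg (mul_nonneg (sub_nonneg.2 hP.ημ_le_δ) hP.k₄_pos.le) ((hu t ht).1 1)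
    linarith

theorem abs_charcoal_le_mul_exp (hP : P.Admissible) {u : ℝ → Fin 3 → ℝ} {T m : ℝ}
    (hu : IsSolutionOn (P.field s) S (Icc 0 T) u) (hm : ∀ t ∈ Icc 0 T, m ≤ u t 1) :
    ∀ t ∈ Icc 0 T, |u t 2| ≤ |u 0 2| * Real.exp (-P.k₂ m * t) :=
  abs_le_mul_exp_of_hasDerivWithinAt_mul (fun _ ht => hu.hasDerivWithinAt_apply ht 2)
    fun t ht => neg_le_neg (hP.k₂_strictMono.monotone (hm t ht))

theorem abs_charcoal_le (hP : P.Admissible) {u : ℝ → Fin 3 → ℝ} {T m : ℝ}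
    (hu : IsSolutionOn (P.field s) S (Icc 0 T) u) (hm : ∀ t ∈ Icc 0 T, m ≤ u t 1) :
    ∀ t ∈ Icc 0 T, |u t 2| ≤ |u 0 2| := fun t ht =>
  (hP.abs_charcoal_le_mul_exp hu hm t ht).trans <| mul_le_of_le_one_right (abs_nonneg _) <|
    Real.exp_le_one_iff.2 <| mul_nonpos_of_nonpos_of_nonneg (neg_nonpos.2 (hP.k₂_pos m).le) ht.1

theorem exists_solution_octant (hP : P.Admissible) (hs : 0 ≤ s) {x : Fin 3 → ℝ}
    (hx : x ∈ octant) : ∃ u, IsSolutionOn (P.field s) octant (Ici 0) u ∧ u 0 = x := by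
  refine exists_isSolutionOn_nonneg_of_quasipositive (hP.locallyLipschitz_field s)
    (fun u hu => hP.field_quasipositive hs hu) hx fun T hT => ?_
  have hμ := hP.μ_pos
  have hδ := hP.δ_pos
  have hm : 0 ≤ P.μ * x 0 + P.δ * x 1 + P.μ * s * T :=
    add_nonneg (add_nonneg (mul_nonneg hμ.le (hx 0)) (mul_nonneg hδ.le (hx 1))) (by positivity)
  set m := P.μ * x 0 + P.δ * x 1 + P.μ * s * T
  refine ⟨m / P.μ + m / P.δ + |x 2|, ?_⟩
  rintro t ⟨ht, htT⟩ u hu rfl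
  have hut : t ∈ Icc 0 t := ⟨ht, le_rfl⟩
  have hpos : ∀ i, 0 ≤ u t i := (hu t hut).1
  have hmass : P.μ * u t 0 + P.δ * u t 1 ≤ m :=
    (hP.mass_le hu t hut).trans (by dsimp only [m]; gcongr)
  have h0 : |u t 0| ≤ m / P.μ := by
    rw [abs_of_nonneg (hpos 0), le_div_iff₀' hμ]
    linarith [mul_nonneg hδ.le (hpos 1)]
  have h1 : |u t 1| ≤ m / P.δ := by
    rw [abs_of_nonneg (hpos 1), le_div_iff₀' hδ]
    linarith [mul_nonneg hμ.le (hpos 0)]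
  have h2 : |u t 2| ≤ |u 0 2| := hP.abs_charcoal_le hu (fun t ht => (hu t ht).1 1) t hut
  have h0' : 0 ≤ m / P.μ := (abs_nonneg _).trans h0
  have h1' : 0 ≤ m / P.δ := (abs_nonneg _).trans h1
  have h2' := abs_nonneg (u 0 2)
  exact (pi_norm_le_iff_of_nonneg (by positivity)).2 fun
    | 0 => h0.trans (by linarith)
    | 1 => h1.trans (by linarith)
    | 2 => h2.trans (by linarith)

/-! ### Equilibria -/

theorem μk₃_pos (hP : P.Admissible) : 0 < P.μ * P.k₃ 0 := mul_pos hP.μ_pos (hP.k₃_pos 0)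

theorem U₁_pos (hP : P.Admissible) : 0 < P.U₁ :=
  Real.rpow_pos_of_pos (div_pos hP.k₄_pos hP.μk₃_pos) _

theorem mul_U₁_rpow (hP : P.Admissible) : P.μ * P.k₃ 0 * P.U₁ ^ P.δ = P.k₄ := by
  rw [U₁, one_div, Real.rpow_inv_rpow (div_pos hP.k₄_pos hP.μk₃_pos).le hP.δ_pos.ne',
    mul_div_cancel₀ _ hP.μk₃_pos.ne']

theorem threshold_pos (hP : P.Admissible) : 0 < P.threshold := mul_pos (hP.k₁_pos 0) hP.U₁_pos

theorem threshold_div (hP : P.Admissible) : P.threshold / P.k₁ 0 = P.U₁ :=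
  mul_div_cancel_left₀ _ (hP.k₁_pos 0).ne'

end Admissible

/-- The net production of organic matter in the state `(U₁, w, 0)`, where the microbes are in
balance. Its zeros are the microbe concentrations of equilibria. -/
def surplus (P : SoilModel) (s w : ℝ) : ℝ :=
  s - P.k₁ w * P.U₁ - P.k₄ / P.μ * (P.δ - P.η * P.μ) * w

theorem microbeEq_iff : P.MicrobeEq s v ↔ P.surplus s v = 0 := by
  rw [MicrobeEq, surplus]
  constructor <;> intro h <;> linarith

theorem surplus_zero : P.surplus s 0 = s - P.threshold := by
  rw [surplus, threshold, mul_zero, sub_zero]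

theorem e₁_ne_e₂ (hv : 0 < v) : P.e₁ s ≠ P.e₂ v := fun h => hv.ne (congrFun h 1)

namespace Admissible

theorem slope_nonneg (hP : P.Admissible) : 0 ≤ P.k₄ / P.μ * (P.δ - P.η * P.μ) :=
  mul_nonneg (div_pos hP.k₄_pos hP.μ_pos).le (sub_nonneg.2 hP.ημ_le_δ)

theorem surplus_strictAnti (hP : P.Admissible) : StrictAnti (P.surplus s) := by
  intro a b hab
  have hdecay := mul_lt_mul_of_pos_right (hP.k₁_strictMono hab) hP.U₁_pos
  have hslope := mul_le_mul_of_nonneg_left hab.le hP.slope_nonneg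
  simp only [surplus]
  linarith

theorem continuous_surplus (hP : P.Admissible) : Continuous (P.surplus s) := by
  have := hP.continuous_k₁
  unfold surplus
  fun_prop

theorem exists_microbeEq (hP : P.Admissible) (hs : P.threshold ≤ s) : ∃ v, P.MicrobeEq s v := by
  rcases hP.ημ_le_δ.eq_or_lt with hbalanced | hlt
  · exact hP.solvable hbalanced.symm s hs
  have hslope : P.k₄ / P.μ * (P.δ - P.η * P.μ) ≠ 0 :=
    (mul_pos (div_pos hP.k₄_pos hP.μ_pos) (sub_pos.2 hlt)).ne'
  have hneg : P.surplus s (s / (P.k₄ / P.μ * (P.δ - P.η * P.μ))) ≤ 0 := by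
    rw [surplus, mul_div_cancel₀ _ hslope, sub_right_comm, sub_self, zero_sub]
    exact neg_nonpos.2 (mul_pos (hP.k₁_pos _) hP.U₁_pos).le
  obtain ⟨v, hv⟩ := mem_range_of_exists_le_of_exists_ge hP.continuous_surplus ⟨_, hneg⟩
    ⟨0, surplus_zero.symm ▸ sub_nonneg.2 hs⟩
  exact ⟨v, microbeEq_iff.2 hv⟩

theorem microbeEq_unique (hP : P.Admissible) {w : ℝ} (hv : P.MicrobeEq s v)
    (hw : P.MicrobeEq s w) : w = v :=
  hP.surplus_strictAnti.injective ((microbeEq_iff.1 hw).trans (microbeEq_iff.1 hv).symm)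

theorem existsUnique_microbeEq (hP : P.Admissible) (hs : P.threshold ≤ s) :
    ∃! v, P.MicrobeEq s v :=
  existsUnique_of_exists_of_unique (hP.exists_microbeEq hs) fun _ _ hv hw =>
    hP.microbeEq_unique hw hv

theorem microbeEq_pos_iff (hP : P.Admissible) (hv : P.MicrobeEq s v) :
    0 < v ↔ P.threshold < s := by
  rw [← hP.surplus_strictAnti.lt_iff_gt, microbeEq_iff.1 hv, surplus_zero, sub_pos]

theorem field_e₁ (hP : P.Admissible) : P.field s (P.e₁ s) = 0 := by
  have hk := (hP.k₁_pos 0).ne'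
  refine funext_fin_three ?_ ?_ ?_
  · simp only [field_zero, e₁, Matrix.cons_val, Pi.zero_apply]
    field_simp
    ring
  · simp only [field_one, e₁, Matrix.cons_val, mul_zero, zero_mul, sub_zero, Pi.zero_apply]
  · simp only [field_two, e₁, Matrix.cons_val, mul_zero, Pi.zero_apply]

theorem field_e₂ (hP : P.Admissible) : P.field s (P.e₂ v) = ![P.surplus s v, 0, 0] := by
  have hμ := hP.μ_pos.ne'
  refine funext_fin_three ?_ ?_ ?_
  · simp only [field_zero, e₂, surplus, Matrix.cons_val]
    field_simp
    linear_combination -(P.δ * v) * hP.mul_U₁_rpow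
  · simp only [field_one, e₂, Matrix.cons_val]
    linear_combination v * hP.mul_U₁_rpow
  · simp only [field_two, e₂, Matrix.cons_val, mul_zero]

theorem field_e₂_eq_zero_iff (hP : P.Admissible) :
    P.field s (P.e₂ v) = 0 ↔ P.MicrobeEq s v := by
  rw [hP.field_e₂, microbeEq_iff]
  exact ⟨fun h => congrFun h 0, fun h => funext_fin_three h rfl rfl⟩

theorem eq_e₁_or_eq_e₂_of_field_eq_zero (hP : P.Admissible) (h : P.field s u = 0)
    (hu : 0 ≤ u 0) : u = P.e₁ s ∨ u = P.e₂ (u 1) := by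
  have h2 : u 2 = 0 := by
    have := congrFun h 2
    rw [field_two] at this
    exact (mul_eq_zero.1 this).resolve_left (neg_ne_zero.2 (hP.k₂_pos _).ne')
  have h1 : u 1 * (P.μ * P.k₃ 0 * u 0 ^ P.δ - P.k₄) = 0 := by
    have := congrFun h 1
    rw [field_one, h2, Pi.zero_apply] at this
    linear_combination this
  refine (mul_eq_zero.1 h1).imp (fun (h1 : u 1 = 0) => funext_fin_three ?_ h1 h2)
    fun h1 => funext_fin_three ?_ rfl h2
  · have h0 := congrFun h 0
    rw [field_zero, h1, Pi.zero_apply] at h0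
    change u 0 = s / P.k₁ 0
    rw [eq_div_iff (hP.k₁_pos 0).ne']
    linear_combination -h0
  · refine (Real.rpow_left_inj hu hP.U₁_pos.le hP.δ_pos.ne').1 (mul_left_cancel₀ hP.μk₃_pos.ne' ?_)
    linear_combination h1 - hP.mul_U₁_rpow

theorem e₁_mem_octant (hP : P.Admissible) (hs : 0 ≤ s) : P.e₁ s ∈ octant
  | 0 => div_nonneg hs (hP.k₁_pos 0).le
  | 1 => le_rfl
  | 2 => le_rfl

theorem mem_equilibria (hP : P.Admissible) (hs : 0 ≤ s) :
    u ∈ equilibria (P.field s) octant ↔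
      u = P.e₁ s ∨ ∃ v, 0 ≤ v ∧ P.MicrobeEq s v ∧ u = P.e₂ v := by
  constructor
  · rintro ⟨hu, h⟩
    exact (hP.eq_e₁_or_eq_e₂_of_field_eq_zero h (hu 0)).imp_right fun heq =>
      ⟨u 1, hu 1, hP.field_e₂_eq_zero_iff.1 (by rwa [← heq]), heq⟩
  · rintro (rfl | ⟨v, hv0, hv, rfl⟩)
    · exact ⟨hP.e₁_mem_octant hs, hP.field_e₁⟩
    · exact ⟨fun | 0 => hP.U₁_pos.le | 1 => hv0 | 2 => le_rfl, hP.field_e₂_eq_zero_iff.2 hv⟩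

theorem equilibria_of_le (hP : P.Admissible) (hs : 0 ≤ s) (h : s ≤ P.threshold) :
    equilibria (P.field s) octant = {P.e₁ s} := by
  ext u
  rw [hP.mem_equilibria hs, mem_singleton_iff, or_iff_left_of_imp]
  rintro ⟨v, hv0, hv, rfl⟩
  obtain rfl : v = 0 := hv0.antisymm' (not_lt.1 ((hP.microbeEq_pos_iff hv).not.2 h.not_gt))
  have hst : s = P.threshold :=
    sub_eq_zero.1 (surplus_zero.symm.trans (microbeEq_iff.1 hv))
  rw [e₁, e₂, hst, hP.threshold_div]

theorem equilibria_of_lt (hP : P.Admissible) (hs : P.threshold < s) (hv : P.MicrobeEq s v) :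
    equilibria (P.field s) octant = {P.e₁ s, P.e₂ v} := by
  ext u
  rw [hP.mem_equilibria (hP.threshold_pos.trans hs).le, mem_insert_iff, mem_singleton_iff]
  refine or_congr_right ⟨?_, fun h => ⟨v, ((hP.microbeEq_pos_iff hv).2 hs).le, hv, h⟩⟩
  rintro ⟨w, -, hw, rfl⟩
  rw [hP.microbeEq_unique hv hw]

theorem not_topologicallyEquivalent (hP : P.Admissible) {s' : ℝ} (hs' : 0 ≤ s')
    (hs't : s' ≤ P.threshold) (hs : P.threshold < s) :
    ¬ TopologicallyEquivalent (P.field s) (P.field s') octant := by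
  intro hequiv
  obtain ⟨φ, hφ⟩ := hequiv.exists_homeomorph_equilibria (hP.locallyLipschitz_field s)
    fun x hx => hP.exists_solution_octant hs' hx
  obtain ⟨v, hv⟩ := hP.exists_microbeEq hs.le
  rw [hP.equilibria_of_lt hs hv, hP.equilibria_of_le hs' hs't] at hφ
  have he₁ : P.e₁ s ∈ octant := hP.e₁_mem_octant (hs'.trans (hs't.trans hs.le))
  have he₂ : P.e₂ v ∈ octant := by
    have hmem : P.e₂ v ∈ equilibria (P.field s) octant := by
      rw [hP.equilibria_of_lt hs hv]; exact Or.inr rfl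
    exact hmem.1
  have hinj : φ ⟨_, he₁⟩ = φ ⟨_, he₂⟩ :=
    Subtype.ext ((hφ ⟨_, he₁⟩ (Or.inl rfl)).trans (hφ ⟨_, he₂⟩ (Or.inr rfl)).symm)
  exact e₁_ne_e₂ ((hP.microbeEq_pos_iff hv).2 hs) (Subtype.ext_iff.1 (φ.injective hinj))

theorem isBifurcationPoint (hP : P.Admissible) :
    IsBifurcationPoint P.field octant (Ici 0) P.threshold := by
  have hright : ∀ᶠ s in 𝓝[>] P.threshold,
      ¬ TopologicallyEquivalent (P.field s) (P.field P.threshold) octant :=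
    eventually_mem_nhdsWithin.mono fun s hs =>
      hP.not_topologicallyEquivalent hP.threshold_pos.le le_rfl hs
  exact ⟨hP.threshold_pos.le, hright.frequently.filter_mono <|
    nhdsWithin_mono _ fun s hs => hP.threshold_pos.le.trans (le_of_lt hs)⟩

end Admissible

end SoilModel

/-! ### Exponential stability -/

section ExponentialStability

variable {n : ℕ} {f : (Fin n → ℝ) → (Fin n → ℝ)} {S : Set (Fin n → ℝ)} {e : Fin n → ℝ} {ρ : ℝ}

/-- Exponential convergence to `e`, with uniform constants, of those solutions that do not leave the
closed ball of radius `ρ`. -/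
def ExponentiallyStableWithin (f : (Fin n → ℝ) → (Fin n → ℝ)) (S : Set (Fin n → ℝ))
    (e : Fin n → ℝ) (ρ : ℝ) : Prop :=
  ∃ C > 0, ∃ c > 0, ∀ T ≥ 0, ∀ u, IsSolutionOn f S (Icc 0 T) u →
    (∀ t ∈ Icc 0 T, dist (u t) e ≤ ρ) →
    ∀ t ∈ Icc 0 T, dist (u t) e ≤ C * dist (u 0) e * Real.exp (-c * t)

theorem ExponentiallyStableWithin.stableWithin (h : ExponentiallyStableWithin f S e ρ) :
    StableWithin f S e ρ := by
  obtain ⟨C, hC, c, hc, hdecay⟩ := h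
  refine fun ε hε => ⟨ε / C, by positivity, fun T hT u hu hρ h0 t ht => ?_⟩
  have hexp : Real.exp (-c * t) ≤ 1 :=
    Real.exp_le_one_iff.2 (mul_nonpos_of_nonpos_of_nonneg (neg_nonpos.2 hc.le) ht.1)
  calc dist (u t) e ≤ C * dist (u 0) e * Real.exp (-c * t) := hdecay T hT u hu hρ t ht
    _ ≤ C * dist (u 0) e := mul_le_of_le_one_right (by positivity) hexp
    _ < ε := (lt_div_iff₀' hC).1 h0

theorem exists_forall_ge_mul_exp_lt (A : ℝ) {c ε : ℝ} (hc : 0 < c) (hε : 0 < ε) :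
    ∃ a ≥ 0, ∀ t ≥ a, A * Real.exp (-c * t) < ε := by
  have hexp : Tendsto (fun t => A * Real.exp (-c * t)) atTop (𝓝 (A * 0)) :=
    (Real.tendsto_exp_atBot.comp
      (tendsto_id.const_mul_atTop_of_neg (neg_neg_of_pos hc))).const_mul A
  rw [mul_zero] at hexp
  obtain ⟨a, ha⟩ := eventually_atTop.1 (hexp.eventually_lt_const hε)
  exact ⟨max a 0, le_max_right _ _, fun t ht => ha t ((le_max_left _ _).trans ht)⟩

theorem ExponentiallyStableWithin.exists_dist_lt (h : ExponentiallyStableWithin f S e ρ)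
    {u : ℝ → Fin n → ℝ} (hu : IsSolutionOn f S (Ici 0) u) (hρ : ∀ t ≥ 0, dist (u t) e ≤ ρ)
    {r : ℝ} (hr : 0 < r) : ∃ t ≥ 0, dist (u t) e < r := by
  obtain ⟨C, _, c, hc, hdecay⟩ := h
  obtain ⟨t, ht, hlt⟩ := exists_forall_ge_mul_exp_lt (C * dist (u 0) e) hc hr
  exact ⟨t, ht, (hdecay t ht u (hu.mono Icc_subset_Ici_self) (fun t ht => hρ t ht.1) t
    (right_mem_Icc.2 ht)).trans_lt (hlt t le_rfl)⟩

theorem ExponentiallyStableWithin.asymptoticallyStable_univ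
    (h : ExponentiallyStableWithin f univ e ρ) (hρ : 0 < ρ) (hf : LocallyLipschitz f) :
    AsymptoticallyStable f univ e :=
  (h.stableWithin.lyapunovStable_univ hρ hf).asymptoticallyStable hρ
    fun _ hu hdist _ hr => h.exists_dist_lt hu hdist hr

end ExponentialStability

section Lipschitz

variable {n : ℕ} {f : (Fin n → ℝ) → (Fin n → ℝ)}

theorem exists_abs_apply_sub_le_of_locallyLipschitz (hf : LocallyLipschitz f) (e : Fin n → ℝ)
    (ρ : ℝ) : ∃ K ≥ 0, ∀ u ∈ Metric.closedBall e ρ, ∀ w ∈ Metric.closedBall e ρ, ∀ i,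
      |f u i - f w i| ≤ K * dist u w := by
  obtain ⟨K, hK⟩ := hf.locallyLipschitzOn.exists_lipschitzOnWith_of_compact
    (isCompact_closedBall e ρ)
  exact ⟨K, K.2, fun u hu w hw i =>
    (dist_le_pi_dist (f u) (f w) i).trans (hK.dist_le_mul u hu w hw)⟩

theorem exists_abs_apply_sub_apply_update_le (hf : LocallyLipschitz f) (e : Fin n → ℝ) (ρ : ℝ)
    (j : Fin n) : ∃ K ≥ 0, ∀ u, dist u e ≤ ρ → ∀ i,
      |f u i - f (Function.update u j (e j)) i| ≤ K * |u j - e j| := by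
  obtain ⟨K, hK0, hK⟩ := exists_abs_apply_sub_le_of_locallyLipschitz hf e ρ
  refine ⟨K, hK0, fun u hu i => ?_⟩
  have hmem : dist (Function.update u j (e j)) e ≤ dist u e := by
    refine (dist_pi_le_iff dist_nonneg).2 fun i => ?_
    rcases eq_or_ne i j with rfl | hij
    · rw [Function.update_self, dist_self]; exact dist_nonneg
    · rw [Function.update_of_ne hij]; exact dist_le_pi_dist u e i
  have hdist : dist u (Function.update u j (e j)) ≤ |u j - e j| := by
    refine (dist_pi_le_iff (abs_nonneg _)).2 fun i => ?_
    rcases eq_or_ne i j with rfl | hij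
    · rw [Function.update_self, Real.dist_eq]
    · rw [Function.update_of_ne hij, dist_self]; exact abs_nonneg _
  exact (hK u hu _ (hmem.trans hu) i).trans (by gcongr)

end Lipschitz

/-! ### The equilibrium without microbes -/

namespace SoilModel

variable {P : SoilModel} {s m : ℝ} {u : Fin 3 → ℝ} {S : Set (Fin 3 → ℝ)}

/-- The per-capita growth rate of the microbes, `u₂' = growth u * u₂`. -/
def growth (P : SoilModel) (u : Fin 3 → ℝ) : ℝ := P.μ * P.k₃ (u 2) * u 0 ^ P.δ - P.k₄

theorem field_one_eq (P : SoilModel) (s : ℝ) (u : Fin 3 → ℝ) :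
    P.field s u 1 = P.growth u * u 1 := by
  rw [field_one, growth]; ring

theorem dist_e₁_le_iff {r : ℝ} (hr : 0 ≤ r) :
    dist u (P.e₁ s) ≤ r ↔ |u 0 - s / P.k₁ 0| ≤ r ∧ |u 1| ≤ r ∧ |u 2| ≤ r := by
  rw [dist_pi_le_iff hr, Fin.forall_fin_succ, Fin.forall_fin_two]
  simp only [e₁, Real.dist_eq, Fin.succ_zero_eq_one, Fin.succ_one_eq_two, Matrix.cons_val,
    sub_zero]

theorem growth_e₁ : P.growth (P.e₁ s) = P.criticalEigenvalue s := rfl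

namespace Admissible

theorem continuous_growth (hP : P.Admissible) : Continuous P.growth := by
  have hk₃ := hP.continuous_k₃
  have hpow : Continuous fun u : Fin 3 → ℝ => u 0 ^ P.δ :=
    (continuous_apply 0).rpow_const fun _ => Or.inr hP.δ_pos.le
  unfold growth
  fun_prop

theorem criticalEigenvalue_neg (hP : P.Admissible) (hs : 0 ≤ s) (h : s < P.threshold) :
    P.criticalEigenvalue s < 0 := by
  have hlt : s / P.k₁ 0 < P.U₁ := (div_lt_iff₀' (hP.k₁_pos 0)).2 h
  rw [criticalEigenvalue, sub_neg]
  calc P.μ * P.k₃ 0 * (s / P.k₁ 0) ^ P.δ < P.μ * P.k₃ 0 * P.U₁ ^ P.δ :=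
        mul_lt_mul_of_pos_left
          (Real.rpow_lt_rpow (div_nonneg hs (hP.k₁_pos 0).le) hlt hP.δ_pos) hP.μk₃_pos
    _ = P.k₄ := hP.mul_U₁_rpow

theorem criticalEigenvalue_pos (hP : P.Admissible) (h : P.threshold < s) :
    0 < P.criticalEigenvalue s := by
  have hlt : P.U₁ < s / P.k₁ 0 := (lt_div_iff₀' (hP.k₁_pos 0)).2 h
  rw [criticalEigenvalue, sub_pos]
  calc P.k₄ = P.μ * P.k₃ 0 * P.U₁ ^ P.δ := hP.mul_U₁_rpow.symm
    _ < P.μ * P.k₃ 0 * (s / P.k₁ 0) ^ P.δ :=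
        mul_lt_mul_of_pos_left (Real.rpow_lt_rpow hP.U₁_pos.le hlt hP.δ_pos) hP.μk₃_pos

theorem exists_abs_field_zero_add_le (hP : P.Admissible) (s ρ : ℝ) :
    ∃ K ≥ 0, ∀ u, dist u (P.e₁ s) ≤ ρ →
      |P.field s u 0 + P.k₁ 0 * (u 0 - s / P.k₁ 0)| ≤ K * |u 1| := by
  obtain ⟨K, hK0, hK⟩ :=
    exists_abs_apply_sub_apply_update_le (hP.locallyLipschitz_field s) (P.e₁ s) ρ 1
  refine ⟨K, hK0, fun u hu => ?_⟩
  have hwithout : P.field s (Function.update u 1 0) 0 = -(P.k₁ 0 * (u 0 - s / P.k₁ 0)) := by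
    rw [field_zero, Function.update_self, Function.update_of_ne Fin.zero_ne_one, mul_sub,
      mul_div_cancel₀ _ (hP.k₁_pos 0).ne']
    ring
  have hlip := hK u hu 0
  rwa [show P.e₁ s 1 = 0 from rfl, hwithout, sub_neg_eq_add, sub_zero] at hlip

theorem exponentiallyStableWithin_e₁ (hP : P.Admissible) {ρ : ℝ} (hρ : ρ ≤ 1) (hm : 0 < m)
    (hgrowth : ∀ u, dist u (P.e₁ s) ≤ ρ → P.growth u ≤ -m) :
    ExponentiallyStableWithin (P.field s) S (P.e₁ s) ρ := by
  obtain ⟨K, hK0, hK⟩ := hP.exists_abs_field_zero_add_le s ρ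
  have hα := half_pos (hP.k₁_pos 0)
  set c := min m (min (P.k₂ (-1)) (P.k₁ 0 / 2))
  have hc : 0 < c := lt_min hm (lt_min (hP.k₂_pos _) hα)
  have hcα : 0 < P.k₁ 0 - c := by
    linarith [(min_le_right m _).trans (min_le_right (P.k₂ (-1)) (P.k₁ 0 / 2))]
  refine ⟨1 + K / (P.k₁ 0 - c), by positivity, c, hc, fun T _ u hu hdist t ht => ?_⟩
  set d := dist (u 0) (P.e₁ s)
  have hd : 0 ≤ d := dist_nonneg
  obtain ⟨horganic₀, hmicrobes₀, hcharcoal₀⟩ := (dist_e₁_le_iff hd).1 le_rfl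
  have hmicrobes : ∀ t ∈ Icc 0 T, |u t 1| ≤ d * Real.exp (-c * t) := fun t ht =>
    (abs_le_mul_exp_of_hasDerivWithinAt_mul
      (fun t ht => (hu.hasDerivWithinAt_apply ht 1).congr_deriv (P.field_one_eq s _))
      (fun t ht => (hgrowth _ (hdist t ht)).trans (neg_le_neg (min_le_left _ _))) t ht).trans
      (by gcongr)
  have hcharcoal : |u t 2| ≤ d * Real.exp (-c * t) := by
    refine (hP.abs_charcoal_le_mul_exp hu (m := -1) (fun t ht => ?_) t ht).trans ?_
    · have hnear := (dist_e₁_le_iff zero_le_one).1 ((hdist t ht).trans hρ)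
      exact (abs_le.1 hnear.2.1).1
    · have := ht.1
      gcongr
      exact (min_le_right _ _).trans (min_le_left _ _)
  have horganic : |u t 0 - s / P.k₁ 0| ≤
      (|u 0 0 - s / P.k₁ 0| + K * d / (P.k₁ 0 - c)) * Real.exp (-c * t) := by
    refine abs_le_mul_exp_of_abs_add_le (sub_pos.1 hcα)
      (fun t ht => (hu.hasDerivWithinAt_apply ht 0).sub_const _) (fun t ht => ?_) t ht
    rw [mul_assoc]
    exact (hK _ (hdist t ht)).trans (by gcongr; exact hmicrobes t ht)
  have hCd : (1 + K / (P.k₁ 0 - c)) * d = d + K * d / (P.k₁ 0 - c) := by ring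
  have hKd : 0 ≤ K * d / (P.k₁ 0 - c) := by positivity
  rw [hCd]
  refine (dist_e₁_le_iff (by positivity)).2 ⟨horganic.trans (by gcongr), ?_, ?_⟩
  · exact (hmicrobes t ht).trans (by gcongr; linarith)
  · exact hcharcoal.trans (by gcongr; linarith)

theorem asymptoticallyStable_univ_e₁ (hP : P.Admissible) (hs : 0 ≤ s) (h : s < P.threshold) :
    AsymptoticallyStable (P.field s) univ (P.e₁ s) := by
  have hneg : ∀ᶠ u in 𝓝 (P.e₁ s), P.growth u < P.criticalEigenvalue s / 2 := by
    refine hP.continuous_growth.continuousAt.eventually_lt_const ?_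
    linarith [growth_e₁ (P := P) (s := s), hP.criticalEigenvalue_neg hs h]
  obtain ⟨ρ, hρ, hball⟩ := Metric.nhds_basis_closedBall.eventually_iff.1 hneg
  refine ExponentiallyStableWithin.asymptoticallyStable_univ (ρ := min ρ 1) ?_
    (lt_min hρ one_pos) (hP.locallyLipschitz_field s)
  refine hP.exponentiallyStableWithin_e₁ (min_le_right _ _)
    (m := -(P.criticalEigenvalue s / 2)) ?_ fun u hu => ?_
  · linarith [hP.criticalEigenvalue_neg hs h]
  · rw [neg_neg]
    exact (hball (hu.trans (min_le_left _ _))).le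

theorem asymptoticallyStable_octant_e₁ (hP : P.Admissible) (hs : 0 ≤ s) (h : s < P.threshold) :
    AsymptoticallyStable (P.field s) octant (P.e₁ s) :=
  (hP.asymptoticallyStable_univ_e₁ hs h).of_univ fun _ hx => hP.exists_solution_octant hs hx

theorem mul_exp_le_microbes {u : ℝ → Fin 3 → ℝ} {T : ℝ} (hT : 0 ≤ T)
    (hu : IsSolutionOn (P.field s) octant (Icc 0 T) u)
    (hgrowth : ∀ t ∈ Icc 0 T, m ≤ P.growth (u t)) : u 0 1 * Real.exp (m * T) ≤ u T 1 := by
  have hneg : -u T 1 ≤ -u 0 1 * Real.exp (m * T) := by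
    refine le_mul_exp_mul_of_hasDerivWithinAt_le_above
      (fun t ht => (hu.hasDerivWithinAt_apply ht 1).fun_neg) le_rfl
      (fun t ht _ => ?_) T (right_mem_Icc.2 hT)
    rw [field_one_eq, mul_neg, neg_le_neg_iff]
    exact mul_le_mul_of_nonneg_right (hgrowth t ht) ((hu t ht).1 1)
  linarith

/-- Microbes introduced at `e₁` grow exponentially as long as the state remains near `e₁`. -/
theorem unstable_e₁ (hP : P.Admissible) (h : P.threshold < s) :
    Unstable (P.field s) octant (P.e₁ s) := by
  have hs : 0 ≤ s := (hP.threshold_pos.trans h).le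
  obtain ⟨m, hm, hmlt⟩ := exists_between (hP.criticalEigenvalue_pos h)
  have hgrowth : ∀ᶠ u in 𝓝 (P.e₁ s), m < P.growth u :=
    hP.continuous_growth.continuousAt.eventually_const_lt hmlt
  obtain ⟨ρ, hρ, hball⟩ := Metric.eventually_nhds_iff.1 hgrowth
  refine ⟨ρ, hρ, fun r hr => ?_⟩
  have hmem : (![s / P.k₁ 0, r / 2, 0] : Fin 3 → ℝ) ∈ octant := fun
    | 0 => div_nonneg hs (hP.k₁_pos 0).le
    | 1 => (half_pos hr).le
    | 2 => le_rfl
  obtain ⟨u, hu, hu0⟩ := hP.exists_solution_octant hs hmem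
  by_contra! hnear
  have hdist0 : dist (u 0) (P.e₁ s) < r := by
    refine ((dist_e₁_le_iff (half_pos hr).le).2 ?_).trans_lt (half_lt_self hr)
    simp only [hu0, Matrix.cons_val, sub_self, abs_zero, abs_of_pos (half_pos hr), le_refl,
      (half_pos hr).le, and_self]
  have hdist : ∀ t ≥ 0, dist (u t) (P.e₁ s) < ρ := fun t ht =>
    hnear t ht u (hu.mono Icc_subset_Ici_self) hdist0
  have hT : 0 ≤ ρ / (r / 2 * m) := by positivity
  set T := ρ / (r / 2 * m) with hTdef
  have hexp : u 0 1 * Real.exp (m * T) ≤ u T 1 :=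
    mul_exp_le_microbes hT (hu.mono Icc_subset_Ici_self) fun t ht => (hball (hdist t ht.1)).le
  rw [hu0, show (![s / P.k₁ 0, r / 2, 0] : Fin 3 → ℝ) 1 = r / 2 from rfl] at hexp
  have hreach : r / 2 * (m * T) = ρ := by
    rw [hTdef]
    field_simp
  have hgrow : r / 2 * (m * T + 1) ≤ r / 2 * Real.exp (m * T) := by
    gcongr
    exact Real.add_one_le_exp _
  have hle : |u T 1| ≤ dist (u T) (P.e₁ s) := ((dist_e₁_le_iff dist_nonneg).1 le_rfl).2.1
  linarith [le_abs_self (u T 1), hdist T hT]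

/-! ### The equilibrium without microbes at the threshold -/

theorem field_zero_le_of_growth_nonneg (hP : P.Admissible) (hu : u ∈ octant)
    (h : 0 ≤ P.growth u) : P.field s u 0 ≤ s - P.k₁ 0 * u 0 := by
  have hfield : 0 ≤ P.δ * P.field s u 1 := by
    rw [field_one_eq]
    exact mul_nonneg hP.δ_pos.le (mul_nonneg h (hu 1))
  have hloss := mul_nonneg (mul_nonneg (sub_nonneg.2 hP.ημ_le_δ) hP.k₄_pos.le) (hu 1)
  have hdecay : P.μ * (P.k₁ 0 * u 0) ≤ P.μ * (P.k₁ (u 1) * u 0) :=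
    mul_le_mul_of_nonneg_left
      (mul_le_mul_of_nonneg_right (hP.k₁_strictMono.monotone (hu 1)) (hu 0)) hP.μ_pos.le
  refine le_of_mul_le_mul_left ?_ hP.μ_pos
  linarith [P.field_mass s u]

theorem growth_nonneg_of_U₁_le (hP : P.Admissible) (hu : 0 ≤ u 2) (h : P.U₁ ≤ u 0) :
    0 ≤ P.growth u := by
  rw [growth, sub_nonneg]
  calc P.k₄ = P.μ * P.k₃ 0 * P.U₁ ^ P.δ := hP.mul_U₁_rpow.symm
    _ ≤ P.μ * P.k₃ (u 2) * u 0 ^ P.δ := by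
      have := hP.μ_pos
      have := hP.k₃_pos (u 2)
      have := hP.δ_pos
      have := hP.U₁_pos
      gcongr
      exact hP.k₃_strictMono.monotone hu

theorem exists_growth_le (hP : P.Admissible) : ∃ C ≥ 0, ∀ q ∈ Icc (0 : ℝ) 1, ∀ u : Fin 3 → ℝ,
    0 ≤ u 0 → u 0 ≤ P.U₁ + q → u 2 ≤ q → P.growth u ≤ C * q := by
  obtain ⟨K, hK0, hK⟩ :=
    exists_abs_apply_sub_le_of_locallyLipschitz (hP.locallyLipschitz_field 0) (P.e₂ 1) 1
  refine ⟨K, hK0, fun q hq u hu0 hu0q hu2q => ?_⟩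
  set w : Fin 3 → ℝ := ![P.U₁ + q, 1, q]
  have hdist : dist w (P.e₂ 1) ≤ q := by
    refine (dist_pi_le_iff hq.1).2 fun | 0 => ?_ | 1 => ?_ | 2 => ?_ <;> rw [Real.dist_eq]
    · simpa only [w, e₂, Matrix.cons_val, add_sub_cancel_left] using (abs_of_nonneg hq.1).le
    · simpa only [w, e₂, Matrix.cons_val, sub_self, abs_zero] using hq.1
    · simpa only [w, e₂, Matrix.cons_val, sub_zero] using (abs_of_nonneg hq.1).le
  have hmono : P.growth u ≤ P.field 0 w 1 := by
    simp only [growth, field_one, w, Matrix.cons_val, mul_one]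
    have := hP.μ_pos
    have := hP.k₃_pos q
    have := hP.δ_pos
    gcongr
    exact hP.k₃_strictMono.monotone hu2q
  have hbalance : P.field 0 (P.e₂ 1) 1 = 0 := by rw [hP.field_e₂]; rfl
  calc P.growth u ≤ P.field 0 w 1 - P.field 0 (P.e₂ 1) 1 := by rwa [hbalance, sub_zero]
    _ ≤ K * dist w (P.e₂ 1) := (le_abs_self _).trans
        (hK w (hdist.trans hq.2) _ (Metric.mem_closedBall_self zero_le_one) 1)
    _ ≤ K * q := by gcongr

theorem organic_sub_le_mul_exp (hP : P.Admissible) {u : ℝ → Fin 3 → ℝ} {T r : ℝ} (hr : 0 ≤ r)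
    (hu : IsSolutionOn (P.field P.threshold) octant (Icc 0 T) u) (h0 : u 0 0 - P.U₁ ≤ r) :
    ∀ t ∈ Icc 0 T, u t 0 - P.U₁ ≤ r * Real.exp (-P.k₁ 0 * t) := by
  refine le_mul_exp_mul_of_hasDerivWithinAt_le_above
    (fun t ht => (hu.hasDerivWithinAt_apply ht 0).sub_const _) h0 fun t ht hlt => ?_
  have hU₁ : P.U₁ ≤ u t 0 := sub_nonneg.1 ((mul_nonneg hr (Real.exp_pos _).le).trans hlt.le)
  have hfield := hP.field_zero_le_of_growth_nonneg (s := P.threshold) (hu t ht).1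
    (hP.growth_nonneg_of_U₁_le ((hu t ht).1 2) hU₁)
  rw [threshold] at hfield ⊢
  linarith

theorem exists_growth_le_mul_exp (hP : P.Admissible) {κ : ℝ} (hκ : 0 < κ) (hκ₁ : κ ≤ P.k₁ 0)
    (hκ₂ : κ ≤ P.k₂ 0) : ∃ C ≥ 0, ∀ r ∈ Icc (0 : ℝ) 1, ∀ T, ∀ u,
    IsSolutionOn (P.field P.threshold) octant (Icc 0 T) u → dist (u 0) (P.e₁ P.threshold) ≤ r →
      ∀ t ∈ Icc 0 T, P.growth (u t) ≤ C * Real.exp (-κ * t) := by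
  obtain ⟨C, hC0, hC⟩ := hP.exists_growth_le
  refine ⟨C, hC0, fun r hr T u hu h0 t ht => ?_⟩
  have ht0 := ht.1
  have hr0 := hr.1
  obtain ⟨horganic₀, -, hcharcoal₀⟩ := (dist_e₁_le_iff hr0).1 h0
  rw [hP.threshold_div] at horganic₀
  have hq : r * Real.exp (-κ * t) ∈ Icc (0 : ℝ) 1 := ⟨by positivity, mul_le_one₀ hr.2
    (Real.exp_pos _).le (Real.exp_le_one_iff.2 (by nlinarith))⟩
  have horganic : u t 0 - P.U₁ ≤ r * Real.exp (-κ * t) :=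
    (hP.organic_sub_le_mul_exp hr0 hu ((le_abs_self _).trans horganic₀) t ht).trans (by gcongr)
  have hcharcoal : |u t 2| ≤ r * Real.exp (-κ * t) :=
    (hP.abs_charcoal_le_mul_exp hu (fun t ht => (hu t ht).1 1) t ht).trans (by gcongr)
  calc P.growth (u t) ≤ C * (r * Real.exp (-κ * t)) :=
        hC _ hq (u t) ((hu t ht).1 0) (by linarith) ((le_abs_self _).trans hcharcoal)
    _ ≤ C * Real.exp (-κ * t) := by
        gcongr
        exact mul_le_of_le_one_left (Real.exp_pos _).le hr.2

theorem le_mul_exp_div_of_growth_le {C κ T : ℝ} (hC0 : 0 ≤ C) (hκ : 0 < κ)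
    {u : ℝ → Fin 3 → ℝ} (hu : IsSolutionOn (P.field s) octant (Icc 0 T) u)
    (hgrowth : ∀ t ∈ Icc 0 T, P.growth (u t) ≤ C * Real.exp (-κ * t)) :
    ∀ t ∈ Icc 0 T, u t 1 ≤ u 0 1 * Real.exp (C / κ) := by
  intro t ht
  have h0 : 0 ≤ u 0 1 := (hu 0 ⟨le_rfl, ht.1.trans ht.2⟩).1 1
  have hΨ : ∀ t, HasDerivAt (fun t => -(C / κ) * Real.exp (-κ * t)) (C * Real.exp (-κ * t)) t :=
    fun t => ((((hasDerivAt_id t).const_mul (-κ)).exp).const_mul (-(C / κ))).congr_deriv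
      (by simp only [id]; field_simp)
  have hbound := le_mul_exp_of_hasDerivWithinAt_le_above (a := u 0 1 * Real.exp (C / κ))
    (fun t ht => hu.hasDerivWithinAt_apply ht 1) (fun t _ => (hΨ t).hasDerivWithinAt) ?_
    (fun t ht _ => ?_) t ht
  · refine hbound.trans (mul_le_of_le_one_right (by positivity) (Real.exp_le_one_iff.2 ?_))
    exact mul_nonpos_of_nonpos_of_nonneg (neg_nonpos.2 (by positivity)) (Real.exp_pos _).le
  · rw [mul_zero, Real.exp_zero, mul_one, mul_assoc, ← Real.exp_add, add_neg_cancel, Real.exp_zero,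
      mul_one]
  · rw [field_one_eq]
    exact mul_le_mul_of_nonneg_right (hgrowth t ht) ((hu t ht).1 1)

/-- At the threshold the growth rate vanishes at `e₁`, but along solutions its positive part is
exponentially small, hence integrable in time. -/
theorem exists_microbes_le (hP : P.Admissible) : ∃ M ≥ 0, ∀ r ∈ Icc (0 : ℝ) 1, ∀ T, ∀ u,
    IsSolutionOn (P.field P.threshold) octant (Icc 0 T) u → dist (u 0) (P.e₁ P.threshold) ≤ r →
      ∀ t ∈ Icc 0 T, |u t 1| ≤ M * r := by
  have hκ : 0 < min (P.k₁ 0) (P.k₂ 0) := lt_min (hP.k₁_pos 0) (hP.k₂_pos 0)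
  obtain ⟨C, hC0, hC⟩ := hP.exists_growth_le_mul_exp hκ (min_le_left _ _) (min_le_right _ _)
  refine ⟨Real.exp (C / min (P.k₁ 0) (P.k₂ 0)), (Real.exp_pos _).le,
    fun r hr T u hu h0 t ht => ?_⟩
  have hmicrobes₀ : u 0 1 ≤ r := (le_abs_self _).trans ((dist_e₁_le_iff hr.1).1 h0).2.1
  rw [abs_of_nonneg ((hu t ht).1 1), mul_comm]
  exact (le_mul_exp_div_of_growth_le hC0 hκ hu (hC r hr T u hu h0) t ht).trans (by gcongr)

theorem stableWithin_e₁_threshold (hP : P.Admissible) (ρ : ℝ) :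
    StableWithin (P.field P.threshold) octant (P.e₁ P.threshold) ρ := by
  obtain ⟨M, hM0, hM⟩ := hP.exists_microbes_le
  obtain ⟨K, hK0, hK⟩ := hP.exists_abs_field_zero_add_le P.threshold ρ
  have hk := hP.k₁_pos 0
  set L := 1 + M + K * M / P.k₁ 0
  have hL : 0 < L := by positivity
  intro ε hε
  refine ⟨min 1 (ε / L), by positivity, fun T _ u hu hdist h0 t ht => ?_⟩
  set r := dist (u 0) (P.e₁ P.threshold)
  have hr : r ∈ Icc (0 : ℝ) 1 := ⟨dist_nonneg, (h0.trans_le (min_le_left _ _)).le⟩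
  have hr0 := hr.1
  obtain ⟨horganic₀, -, hcharcoal₀⟩ := (dist_e₁_le_iff hr0).1 (le_refl r)
  have hmicrobes : ∀ t ∈ Icc 0 T, |u t 1| ≤ M * r := hM r hr T u hu le_rfl
  have horganic : |u t 0 - P.threshold / P.k₁ 0| ≤ r + K * (M * r) / P.k₁ 0 := by
    have habs := abs_le_mul_exp_of_abs_add_le (c := 0) hk (B := K * (M * r))
      (fun t ht => (hu.hasDerivWithinAt_apply ht 0).sub_const (P.threshold / P.k₁ 0))
      (fun t ht => ?_) t ht
    · rw [neg_zero, zero_mul, Real.exp_zero, mul_one, sub_zero] at habs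
      exact habs.trans (by gcongr)
    · rw [neg_zero, zero_mul, Real.exp_zero, mul_one]
      exact (hK _ (hdist t ht)).trans (by gcongr; exact hmicrobes t ht)
  have hcharcoal : |u t 2| ≤ r :=
    (hP.abs_charcoal_le hu (fun t ht => (hu t ht).1 1) t ht).trans hcharcoal₀
  have hLr : L * r = r + M * r + K * (M * r) / P.k₁ 0 := by simp only [L]; ring
  have hKM : 0 ≤ K * (M * r) / P.k₁ 0 := by positivity
  have hMr : 0 ≤ M * r := by positivity
  refine lt_of_le_of_lt ?_ ((lt_div_iff₀' hL).1 (h0.trans_le (min_le_right 1 (ε / L))))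
  exact (dist_e₁_le_iff (by positivity)).2 ⟨horganic.trans (by linarith),
    (hmicrobes t ht).trans (by linarith), hcharcoal.trans (by linarith)⟩

theorem lyapunovStable_e₁_threshold (hP : P.Admissible) :
    LyapunovStable (P.field P.threshold) octant (P.e₁ P.threshold) :=
  (hP.stableWithin_e₁_threshold 1).lyapunovStable one_pos
    fun _ hx => hP.exists_solution_octant hP.threshold_pos.le hx

end Admissible

end SoilModel

/-! ### Potentials -/

section Potential

variable {g : ℝ → ℝ} {a : ℝ}

/-- The primitive of `g` that vanishes at `a`. If `g x` has the sign of `x - a`, then `a` is its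
strict minimum, and it serves as one summand of a Lyapunov function. -/
def potential (g : ℝ → ℝ) (a x : ℝ) : ℝ := ∫ y in a..x, g y

theorem potential_self : potential g a a = 0 := intervalIntegral.integral_same

theorem hasDerivAt_potential (hg : Continuous g) (x : ℝ) :
    HasDerivAt (potential g a) (g x) x :=
  intervalIntegral.integral_hasDerivAt_right (hg.intervalIntegrable _ _)
    (hg.stronglyMeasurableAtFilter _ _) hg.continuousAt

theorem continuous_potential (hg : Continuous g) : Continuous (potential g a) :=
  continuous_iff_continuousAt.2 fun x => (hasDerivAt_potential hg x).continuousAt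

theorem strictMonoOn_potential (hg : Continuous g) (h : ∀ x ≠ a, 0 < (x - a) * g x) :
    StrictMonoOn (potential g a) (Ici a) := by
  refine strictMonoOn_of_deriv_pos (convex_Ici a) (continuous_potential hg).continuousOn
    fun x hx => ?_
  rw [interior_Ici] at hx
  rw [(hasDerivAt_potential hg x).deriv]
  exact (pos_iff_pos_of_mul_pos (h x (ne_of_gt hx))).1 (sub_pos.2 hx)

theorem strictAntiOn_potential (hg : Continuous g) (h : ∀ x ≠ a, 0 < (x - a) * g x) :
    StrictAntiOn (potential g a) (Iic a) := by
  refine strictAntiOn_of_deriv_neg (convex_Iic a) (continuous_potential hg).continuousOn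
    fun x hx => ?_
  rw [interior_Iic] at hx
  rw [(hasDerivAt_potential hg x).deriv]
  exact (neg_iff_neg_of_mul_pos (h x (ne_of_lt hx))).1 (sub_neg.2 hx)

theorem potential_nonneg (hg : Continuous g) (h : ∀ x ≠ a, 0 < (x - a) * g x) (x : ℝ) :
    0 ≤ potential g a x := by
  rw [← potential_self (g := g) (a := a)]
  rcases le_total a x with hx | hx
  · exact (strictMonoOn_potential hg h).monotoneOn self_mem_Ici hx hx
  · exact (strictAntiOn_potential hg h).antitoneOn hx self_mem_Iic hx

theorem exists_forall_potential_lt_imp_abs_sub_lt (hg : Continuous g)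
    (h : ∀ x ≠ a, 0 < (x - a) * g x) {ε : ℝ} (hε : 0 < ε) :
    ∃ η > 0, ∀ x, potential g a x < η → |x - a| < ε := by
  have hmono := strictMonoOn_potential hg h
  have hanti := strictAntiOn_potential hg h
  have hright : a < a + ε := lt_add_of_pos_right a hε
  have hleft : a - ε < a := sub_lt_self a hε
  refine ⟨min (potential g a (a - ε)) (potential g a (a + ε)), lt_min ?_ ?_, fun x hx => ?_⟩
  · exact potential_self.symm.trans_lt (hanti hleft.le self_mem_Iic hleft)
  · exact potential_self.symm.trans_lt (hmono self_mem_Ici hright.le hright)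
  · contrapose! hx
    rcases le_abs'.1 hx with hx | hx
    · exact (min_le_left _ _).trans
        (hanti.antitoneOn (mem_Iic.2 (by linarith)) hleft.le (by linarith))
    · exact (min_le_right _ _).trans
        (hmono.monotoneOn hright.le (mem_Ici.2 (by linarith)) (by linarith))

end Potential

/-! ### Lower bounds for dissipation -/

theorem rpow_sub_one_mul_sub_sq_le {a b p : ℝ} (ha : 0 < a) (hb : 0 < b) (hp : 1 ≤ p) :
    b ^ (p - 1) * (a - b) ^ 2 ≤ (a - b) * (a ^ p - b ^ p) := by
  have hfactor : ∀ c : ℝ, 0 < c → c ^ p = c * c ^ (p - 1) := fun c hc => by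
    rw [Real.rpow_sub_one hc.ne', mul_div_cancel₀ _ hc.ne']
  have hmono : 0 ≤ (a - b) * (a ^ (p - 1) - b ^ (p - 1)) := by
    rcases le_total a b with h | h
    · exact mul_nonneg_of_nonpos_of_nonpos (sub_nonpos.2 h)
        (sub_nonpos.2 (Real.rpow_le_rpow ha.le h (sub_nonneg.2 hp)))
    · exact mul_nonneg (sub_nonneg.2 h)
        (sub_nonneg.2 (Real.rpow_le_rpow hb.le h (sub_nonneg.2 hp)))
  rw [hfactor a ha, hfactor b hb]
  linarith [mul_nonneg ha.le hmono]

section StrictAnti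

variable {g : ℝ → ℝ} {a : ℝ}

theorem mul_sub_nonpos_of_antitone (hg : Antitone g) (h0 : g a = 0) (x : ℝ) :
    g x * (x - a) ≤ 0 := by
  rcases le_total a x with hx | hx
  · exact mul_nonpos_of_nonpos_of_nonneg (h0 ▸ hg hx) (sub_nonneg.2 hx)
  · exact mul_nonpos_of_nonneg_of_nonpos (h0 ▸ hg hx) (sub_nonpos.2 hx)

theorem exists_mul_sub_le_neg_of_strictAnti (hg : StrictAnti g) (h0 : g a = 0) {r : ℝ}
    (hr : 0 < r) : ∃ h > 0, ∀ x, r ≤ |x - a| → g x * (x - a) ≤ -h := by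
  have hleft : 0 < g (a - r) := h0 ▸ hg (sub_lt_self a hr)
  have hright : 0 < -g (a + r) := neg_pos.2 (h0 ▸ hg (lt_add_of_pos_right a hr))
  refine ⟨min (g (a - r)) (-g (a + r)) * r, mul_pos (lt_min hleft hright) hr, fun x hx => ?_⟩
  rcases le_abs'.1 hx with hx | hx
  · have hgx : g (a - r) ≤ g x := hg.antitone (by linarith)
    linarith [mul_le_mul ((min_le_left _ (-g (a + r))).trans hgx) (le_neg.1 hx) hr.le
      (hleft.le.trans hgx)]
  · have hgx : -g (a + r) ≤ -g x := neg_le_neg (hg.antitone (by linarith))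
    linarith [mul_le_mul ((min_le_right (g (a - r)) _).trans hgx) hx hr.le (hright.le.trans hgx)]

end StrictAnti

theorem exists_neg_mul_sq_add_le {C h r : ℝ} (hh : 0 < h) (hr : 0 < r) :
    ∃ M ≥ 0, ∀ x k : ℝ, k ≤ 0 → r ≤ |x| ∨ k ≤ -h → -M * x ^ 2 + k + C * |x| ≤ -(h / 2) := by
  refine ⟨C ^ 2 / (2 * h) + h / r ^ 2, by positivity, fun x k hk hxk => ?_⟩
  have hAMGM : C * |x| ≤ h / 2 + C ^ 2 / (2 * h) * x ^ 2 := by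
    have hsq : 0 ≤ (h - C * |x|) ^ 2 / (2 * h) := by positivity
    have hexpand : (h - C * |x|) ^ 2 / (2 * h) =
        h / 2 - C * |x| + C ^ 2 / (2 * h) * |x| ^ 2 := by field_simp; ring
    rw [hexpand, sq_abs] at hsq
    linarith
  rcases hxk with hx | hk
  · have hfar : h ≤ h / r ^ 2 * x ^ 2 := by
      calc h = h / r ^ 2 * r ^ 2 := (div_mul_cancel₀ h (by positivity)).symm
        _ ≤ h / r ^ 2 * x ^ 2 := by rw [← sq_abs x]; gcongr
    linarith
  · linarith [show 0 ≤ h / r ^ 2 * x ^ 2 by positivity]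

theorem exists_lt_deriv_of_bddBelow {φ φ' : ℝ → ℝ} {a B c : ℝ} (hc : 0 < c)
    (h : ∀ t ≥ a, HasDerivWithinAt φ (φ' t) (Ici a) t) (hB : ∀ t ≥ a, B ≤ φ t) :
    ∃ t ≥ a, -c < φ' t := by
  by_contra! hle
  set b := a + (φ a - B + 1) / c
  have hab : a ≤ b := le_add_of_nonneg_right (div_nonneg (by linarith [hB a le_rfl]) hc.le)
  have hanti : AntitoneOn (fun t => φ t + c * t) (Icc a b) :=
    antitoneOn_Icc_of_hasDerivWithinAt_nonpos
      (fun t ht => ((h t ht.1).mono Icc_subset_Ici_self).fun_add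
        ((hasDerivWithinAt_id t _).const_mul c))
      fun t ht => by linarith [hle t ht.1.le]
  have hdrop := hanti ⟨le_rfl, hab⟩ ⟨hab, le_rfl⟩ hab
  have hcb : c * b = c * a + (φ a - B + 1) := by rw [mul_add, mul_div_cancel₀ _ hc.ne']
  linarith [hB b hab]

/-! ### The equilibrium with microbes -/

namespace SoilModel

variable {P : SoilModel} {s v r : ℝ} {u : Fin 3 → ℝ} {S : Set (Fin 3 → ℝ)}

/-- The per-capita growth rate of the microbes without charcoal. The truncation at `0` makes it
negative on all of `(-∞, U₁)`, independently of the convention for powers of negative reals. -/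
def baseGrowth (P : SoilModel) (x : ℝ) : ℝ := P.μ * P.k₃ 0 * (max x 0) ^ P.δ - P.k₄

/-- The shortage of organic matter per unit of microbes in the state `(U₁, w, 0)`. The lower bound
on the denominator makes it continuous in `w` and is inactive close to `v`. -/
def deficit (P : SoilModel) (s v w : ℝ) : ℝ := -P.surplus s w / max w (v / 2)

/-- The Lyapunov function of the subsystem without charcoal at `(U₁, v, 0)`. -/
def lyapunov (P : SoilModel) (s v : ℝ) (u : Fin 3 → ℝ) : ℝ :=
  potential P.baseGrowth P.U₁ (u 0) + potential (P.deficit s v) v (u 1)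

/-- The derivative of the Lyapunov function along solutions. -/
def lyapunovDeriv (P : SoilModel) (s v : ℝ) (u : Fin 3 → ℝ) : ℝ :=
  P.baseGrowth (u 0) * P.field s u 0 + P.deficit s v (u 1) * P.field s u 1

/-- The radius of a ball around `(U₁, v, 0)` on which the first two coordinates are at least half
their values at the centre. -/
def radius (P : SoilModel) (v : ℝ) : ℝ := min (P.U₁ / 2) (v / 2)

theorem half_le_of_dist_e₂_le (hu : dist u (P.e₂ v) ≤ P.radius v) :
    P.U₁ / 2 ≤ u 0 ∧ v / 2 ≤ u 1 := by
  have h0 : |u 0 - P.U₁| ≤ P.U₁ / 2 :=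
    (dist_le_pi_dist u (P.e₂ v) 0).trans (hu.trans (min_le_left _ _))
  have h1 : |u 1 - v| ≤ v / 2 := (dist_le_pi_dist u (P.e₂ v) 1).trans (hu.trans (min_le_right _ _))
  constructor
  · linarith [(abs_le.1 h0).1]
  · linarith [(abs_le.1 h1).1]

theorem dist_e₂_le {w : ℝ} : dist u (P.e₂ w) ≤ |u 0 - P.U₁| + |u 1 - w| + |u 2| := by
  have h0 := abs_nonneg (u 0 - P.U₁)
  have h1 := abs_nonneg (u 1 - w)
  have h2 := abs_nonneg (u 2)
  refine (dist_pi_le_iff (by positivity)).2 fun | 0 => ?_ | 1 => ?_ | 2 => ?_ <;>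
    rw [Real.dist_eq]
  · change |u 0 - P.U₁| ≤ _; linarith
  · change |u 1 - w| ≤ _; linarith
  · change |u 2 - 0| ≤ _; rw [sub_zero]; linarith

theorem dist_e₂_lt_iff : dist u (P.e₂ v) < r ↔ |u 0 - P.U₁| < r ∧ |u 1 - v| < r ∧ |u 2| < r := by
  constructor
  · intro h
    have hcharcoal : |u 2 - 0| < r := (dist_le_pi_dist u (P.e₂ v) 2).trans_lt h
    exact ⟨(dist_le_pi_dist u (P.e₂ v) 0).trans_lt h, (dist_le_pi_dist u (P.e₂ v) 1).trans_lt h,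
      sub_zero (u 2) ▸ hcharcoal⟩
  · rintro ⟨h0, h1, h2⟩
    refine (dist_pi_lt_iff ((abs_nonneg _).trans_lt h0)).2 fun | 0 => h0 | 1 => h1 | 2 => ?_
    rw [Real.dist_eq]
    exact (sub_zero (u 2)).symm ▸ h2

theorem lyapunov_e₂ : P.lyapunov s v (P.e₂ v) = 0 :=
  (congrArg₂ (· + ·) potential_self potential_self).trans (add_zero 0)

namespace Admissible

theorem radius_pos (hP : P.Admissible) (hv : 0 < v) : 0 < P.radius v :=
  lt_min (half_pos hP.U₁_pos) (half_pos hv)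

theorem continuous_baseGrowth (hP : P.Admissible) : Continuous P.baseGrowth := by
  have hpow : Continuous fun x : ℝ => (max x 0) ^ P.δ :=
    (continuous_id.max continuous_const).rpow_const fun _ => Or.inr hP.δ_pos.le
  unfold baseGrowth
  fun_prop

theorem baseGrowth_eq (hP : P.Admissible) (x : ℝ) :
    P.baseGrowth x = P.μ * P.k₃ 0 * ((max x 0) ^ P.δ - P.U₁ ^ P.δ) := by
  rw [baseGrowth, mul_sub, hP.mul_U₁_rpow]

theorem sub_mul_baseGrowth_pos (hP : P.Admissible) {x : ℝ} (hx : x ≠ P.U₁) :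
    0 < (x - P.U₁) * P.baseGrowth x := by
  rw [hP.baseGrowth_eq]
  rcases hx.lt_or_gt with hx | hx
  · exact mul_pos_of_neg_of_neg (sub_neg.2 hx) (mul_neg_of_pos_of_neg hP.μk₃_pos
      (sub_neg.2 (Real.rpow_lt_rpow (le_max_right _ _) (max_lt hx hP.U₁_pos) hP.δ_pos)))
  · exact mul_pos (sub_pos.2 hx) (mul_pos hP.μk₃_pos
      (sub_pos.2 (Real.rpow_lt_rpow hP.U₁_pos.le (lt_max_of_lt_left hx) hP.δ_pos)))

theorem continuous_deficit (hP : P.Admissible) (hv : 0 < v) : Continuous (P.deficit s v) :=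
  hP.continuous_surplus.neg.div (continuous_id.max continuous_const)
    fun _ => (lt_max_of_lt_right (half_pos hv)).ne'

theorem sub_mul_deficit_pos (hP : P.Admissible) (hv : 0 < v) (heq : P.MicrobeEq s v) {w : ℝ}
    (hw : w ≠ v) : 0 < (w - v) * P.deficit s v w := by
  have hanti := hP.surplus_strictAnti (s := s)
  have hzero := microbeEq_iff.1 heq
  have hden : 0 < max w (v / 2) := lt_max_of_lt_right (half_pos hv)
  rcases hw.lt_or_gt with hw | hw
  · exact mul_pos_of_neg_of_neg (sub_neg.2 hw)
      (div_neg_of_neg_of_pos (neg_neg_of_pos (hzero ▸ hanti hw)) hden)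
  · exact mul_pos (sub_pos.2 hw) (div_pos (neg_pos.2 (hzero ▸ hanti hw)) hden)

theorem continuous_lyapunov (hP : P.Admissible) (hv : 0 < v) : Continuous (P.lyapunov s v) :=
  ((continuous_potential hP.continuous_baseGrowth).comp (continuous_apply 0)).add
    ((continuous_potential (hP.continuous_deficit hv)).comp (continuous_apply 1))

theorem hasDerivWithinAt_lyapunov (hP : P.Admissible) (hv : 0 < v) {I : Set ℝ}
    {u : ℝ → Fin 3 → ℝ} (hu : IsSolutionOn (P.field s) S I u) {t : ℝ} (ht : t ∈ I) :
    HasDerivWithinAt (fun t => P.lyapunov s v (u t)) (P.lyapunovDeriv s v (u t)) I t := by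
  have h0 := hasDerivAt_potential (a := P.U₁) hP.continuous_baseGrowth (u t 0)
  have h1 := hasDerivAt_potential (a := v) (hP.continuous_deficit (s := s) hv) (u t 1)
  exact (h0.comp_hasDerivWithinAt t (hu.hasDerivWithinAt_apply ht 0)).add
    (h1.comp_hasDerivWithinAt t (hu.hasDerivWithinAt_apply ht 1))

theorem exists_forall_lyapunov_lt_imp (hP : P.Admissible) (hv : 0 < v) (heq : P.MicrobeEq s v)
    {ε : ℝ} (hε : 0 < ε) :
    ∃ η > 0, ∀ u, P.lyapunov s v u < η → |u 0 - P.U₁| < ε ∧ |u 1 - v| < ε := by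
  obtain ⟨η₀, hη₀, h₀⟩ := exists_forall_potential_lt_imp_abs_sub_lt hP.continuous_baseGrowth
    (fun _ => hP.sub_mul_baseGrowth_pos) hε
  obtain ⟨η₁, hη₁, h₁⟩ := exists_forall_potential_lt_imp_abs_sub_lt
    (hP.continuous_deficit (s := s) hv) (fun _ => hP.sub_mul_deficit_pos hv heq) hε
  refine ⟨min η₀ η₁, lt_min hη₀ hη₁, fun u hu => ?_⟩
  have hpot₀ := potential_nonneg hP.continuous_baseGrowth (fun _ => hP.sub_mul_baseGrowth_pos) (u 0)
  have hpot₁ := potential_nonneg (hP.continuous_deficit (s := s) hv)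
    (fun _ => hP.sub_mul_deficit_pos hv heq) (u 1)
  rw [lyapunov, lt_min_iff] at hu
  exact ⟨h₀ _ (by linarith), h₁ _ (by linarith)⟩

theorem field_zero_of_charcoal_eq_zero (hP : P.Admissible) (h0 : 0 ≤ u 0) (h2 : u 2 = 0) :
    P.field s u 0 = P.surplus s (u 1) - P.k₁ (u 1) * (u 0 - P.U₁)
      - P.δ / P.μ * u 1 * P.baseGrowth (u 0) := by
  have := hP.μ_pos.ne'
  rw [field_zero, surplus, baseGrowth, max_eq_left h0, h2]
  field_simp
  ring

theorem lyapunovDeriv_of_charcoal_eq_zero (hP : P.Admissible) (hv : 0 < v) (h0 : 0 ≤ u 0)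
    (h1 : v / 2 ≤ u 1) (h2 : u 2 = 0) : P.lyapunovDeriv s v u =
      -(P.k₁ (u 1) * ((u 0 - P.U₁) * P.baseGrowth (u 0)))
        - P.δ / P.μ * u 1 * P.baseGrowth (u 0) ^ 2 := by
  have hu1 : u 1 ≠ 0 := ((half_pos hv).trans_le h1).ne'
  have hfield : P.field s u 1 = u 1 * P.baseGrowth (u 0) := by
    rw [field_one, baseGrowth, max_eq_left h0, h2]; ring
  rw [lyapunovDeriv, hP.field_zero_of_charcoal_eq_zero h0 h2, hfield, deficit, max_eq_left h1]
  field_simp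
  ring

theorem lyapunovDeriv_le_of_charcoal_eq_zero (hP : P.Admissible) (hv : 0 < v) (h0 : 0 < u 0)
    (h1 : v / 2 ≤ u 1) (h2 : u 2 = 0) : P.lyapunovDeriv s v u ≤
      -(P.k₁ 0 * (P.μ * P.k₃ 0 * P.U₁ ^ (P.δ - 1))) * (u 0 - P.U₁) ^ 2 := by
  have hu1 : 0 ≤ u 1 := (half_pos hv).le.trans h1
  have hU₁ := hP.U₁_pos
  have hμk₃ := hP.μk₃_pos
  have hgrowth : P.μ * P.k₃ 0 * (P.U₁ ^ (P.δ - 1) * (u 0 - P.U₁) ^ 2) ≤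
      (u 0 - P.U₁) * P.baseGrowth (u 0) := by
    rw [hP.baseGrowth_eq, max_eq_left h0.le, mul_left_comm (u 0 - P.U₁)]
    exact mul_le_mul_of_nonneg_left (rpow_sub_one_mul_sub_sq_le h0 hU₁ hP.one_le_δ) hμk₃.le
  have hdecay := mul_le_mul (hP.k₁_strictMono.monotone hu1) hgrowth (by positivity)
    (hP.k₁_pos _).le
  have hsq : 0 ≤ P.δ / P.μ * u 1 * P.baseGrowth (u 0) ^ 2 :=
    mul_nonneg (mul_nonneg (div_pos hP.δ_pos hP.μ_pos).le hu1) (sq_nonneg _)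
  rw [hP.lyapunovDeriv_of_charcoal_eq_zero hv h0.le h1 h2]
  linarith

theorem exists_lyapunovDeriv_le (hP : P.Admissible) (hv : 0 < v) :
    ∃ m > 0, ∃ C ≥ 0, ∀ u, dist u (P.e₂ v) ≤ P.radius v →
      P.lyapunovDeriv s v u ≤ -m * (u 0 - P.U₁) ^ 2 + C * |u 2| := by
  obtain ⟨K, hK0, hK⟩ := exists_abs_apply_sub_apply_update_le (hP.locallyLipschitz_field s)
    (P.e₂ v) (P.radius v) 2
  have hcont : Continuous fun u : Fin 3 → ℝ => |P.baseGrowth (u 0)| + |P.deficit s v (u 1)| := by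
    have := hP.continuous_baseGrowth
    have := hP.continuous_deficit (s := s) hv
    fun_prop
  obtain ⟨B, hB⟩ := (isCompact_closedBall (P.e₂ v) (P.radius v)).exists_bound_of_continuousOn
    hcont.continuousOn
  have hB0 : 0 ≤ B := (norm_nonneg _).trans
    (hB (P.e₂ v) (Metric.mem_closedBall_self (hP.radius_pos hv).le))
  refine ⟨P.k₁ 0 * (P.μ * P.k₃ 0 * P.U₁ ^ (P.δ - 1)), mul_pos (hP.k₁_pos 0)
    (mul_pos hP.μk₃_pos (Real.rpow_pos_of_pos hP.U₁_pos _)), B * K, by positivity, fun u hu => ?_⟩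
  obtain ⟨h0, h1⟩ := half_le_of_dist_e₂_le hu
  set w := Function.update u 2 0
  have hpure : P.lyapunovDeriv s v w ≤
      -(P.k₁ 0 * (P.μ * P.k₃ 0 * P.U₁ ^ (P.δ - 1))) * (u 0 - P.U₁) ^ 2 :=
    hP.lyapunovDeriv_le_of_charcoal_eq_zero (u := w) hv ((half_pos hP.U₁_pos).trans_le h0) h1 rfl
  have hK' : ∀ i, |P.field s u i - P.field s w i| ≤ K * |u 2| := fun i => by
    simpa only [e₂, Matrix.cons_val, sub_zero] using hK u hu i
  have herror : P.lyapunovDeriv s v u - P.lyapunovDeriv s v w ≤ B * (K * |u 2|) :=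
    calc P.lyapunovDeriv s v u - P.lyapunovDeriv s v w
        = P.baseGrowth (u 0) * (P.field s u 0 - P.field s w 0)
          + P.deficit s v (u 1) * (P.field s u 1 - P.field s w 1) := by
          simp only [lyapunovDeriv, show w 0 = u 0 from rfl, show w 1 = u 1 from rfl]; ring
      _ ≤ |P.baseGrowth (u 0)| * (K * |u 2|) + |P.deficit s v (u 1)| * (K * |u 2|) := by
          refine add_le_add ?_ ?_ <;> refine (le_abs_self _).trans ?_ <;> rw [abs_mul] <;> gcongr
          exacts [hK' 0, hK' 1]
      _ ≤ B * (K * |u 2|) := by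
          rw [← add_mul]
          gcongr
          exact (le_abs_self _).trans (hB u hu)
  linarith

/-- Away from `u₂ = v` the production term `(u₁ - U₁) (u₂ - v)` decreases, since the surplus has the
sign of `v - u₂`. This compensates for the vanishing of `lyapunovDeriv` on `u₁ = U₁`. -/
theorem exists_cross_le (hP : P.Admissible) (s v ρ : ℝ) : ∃ C ≥ 0, ∀ u, dist u (P.e₂ v) ≤ ρ →
    P.field s u 0 * (u 1 - v) + (u 0 - P.U₁) * P.field s u 1 ≤
      P.surplus s (u 1) * (u 1 - v) + C * |u 0 - P.U₁| + C * |u 2| := by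
  obtain ⟨K, hK0, hK⟩ :=
    exists_abs_apply_sub_le_of_locallyLipschitz (hP.locallyLipschitz_field s) (P.e₂ v) |ρ|
  refine ⟨2 * |ρ| * K, by positivity, fun u hu => ?_⟩
  have hu := hu.trans (le_abs_self ρ)
  have h0 : |u 0 - P.U₁| ≤ |ρ| := (dist_le_pi_dist u (P.e₂ v) 0).trans hu
  have h1 : |u 1 - v| ≤ |ρ| := (dist_le_pi_dist u (P.e₂ v) 1).trans hu
  have hmem : dist (P.e₂ (u 1)) (P.e₂ v) ≤ |ρ| := by
    refine dist_e₂_le.trans ?_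
    simpa only [e₂, Matrix.cons_val, sub_self, abs_zero, zero_add, add_zero] using h1
  have hdist : dist u (P.e₂ (u 1)) ≤ |u 0 - P.U₁| + |u 2| := by
    simpa only [sub_self, abs_zero, add_zero] using dist_e₂_le (P := P) (u := u) (w := u 1)
  have hfield : ∀ i, |P.field s u i - ![P.surplus s (u 1), 0, 0] i| ≤
      K * (|u 0 - P.U₁| + |u 2|) := fun i => by
    rw [← hP.field_e₂]
    exact (hK u hu _ hmem i).trans (by gcongr)
  calc P.field s u 0 * (u 1 - v) + (u 0 - P.U₁) * P.field s u 1
      = P.surplus s (u 1) * (u 1 - v) + ((P.field s u 0 - P.surplus s (u 1)) * (u 1 - v)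
        + (u 0 - P.U₁) * (P.field s u 1 - 0)) := by ring
    _ ≤ P.surplus s (u 1) * (u 1 - v) + (K * (|u 0 - P.U₁| + |u 2|) * |ρ|
        + |ρ| * (K * (|u 0 - P.U₁| + |u 2|))) := by
        refine add_le_add le_rfl (add_le_add ?_ ?_) <;> refine (le_abs_self _).trans ?_ <;>
          rw [abs_mul]
        · exact mul_le_mul (hfield 0) h1 (abs_nonneg _) (by positivity)
        · exact mul_le_mul h0 (hfield 1) (abs_nonneg _) (abs_nonneg _)
    _ = P.surplus s (u 1) * (u 1 - v) + 2 * |ρ| * K * |u 0 - P.U₁| + 2 * |ρ| * K * |u 2| := by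
        ring

theorem abs_charcoal_le_of_dist_e₂_le (hP : P.Admissible) (hv : 0 < v) {T : ℝ}
    {u : ℝ → Fin 3 → ℝ} (hu : IsSolutionOn (P.field s) S (Icc 0 T) u)
    (hdist : ∀ t ∈ Icc 0 T, dist (u t) (P.e₂ v) ≤ P.radius v) :
    ∀ t ∈ Icc 0 T, |u t 2| ≤ |u 0 2| * Real.exp (-P.k₂ 0 * t) :=
  hP.abs_charcoal_le_mul_exp hu fun t ht =>
    (half_pos hv).le.trans (half_le_of_dist_e₂_le (hdist t ht)).2

theorem exists_lyapunov_le (hP : P.Admissible) (hv : 0 < v) : ∃ C ≥ 0, ∀ T, ∀ u,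
    IsSolutionOn (P.field s) S (Icc 0 T) u →
    (∀ t ∈ Icc 0 T, dist (u t) (P.e₂ v) ≤ P.radius v) →
      ∀ t ∈ Icc 0 T, P.lyapunov s v (u t) ≤ P.lyapunov s v (u 0) + C * |u 0 2| := by
  obtain ⟨m, hm, C, hC, hderiv⟩ := hP.exists_lyapunovDeriv_le (s := s) hv
  have hκ := hP.k₂_pos 0
  refine ⟨C / P.k₂ 0, by positivity, fun T u hu hdist t ht => ?_⟩
  have herr : ∀ t, HasDerivAt (fun t => C / P.k₂ 0 * (|u 0 2| * Real.exp (-P.k₂ 0 * t)))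
      (-(C * (|u 0 2| * Real.exp (-P.k₂ 0 * t)))) t := fun t =>
    (((((hasDerivAt_id t).const_mul (-P.k₂ 0)).exp).const_mul |u 0 2|).const_mul
      (C / P.k₂ 0)).congr_deriv (by simp only [id]; field_simp)
  have hle := le_of_hasDerivWithinAt_nonpos_above
    (fun t ht => (hP.hasDerivWithinAt_lyapunov hv hu ht).fun_add (herr t).hasDerivWithinAt)
    (fun t ht _ => ?_) le_rfl t ht
  · rw [mul_zero, Real.exp_zero, mul_one] at hle
    exact (le_add_of_nonneg_right (by positivity)).trans hle
  · have hcharcoal : C * |u t 2| ≤ C * (|u 0 2| * Real.exp (-P.k₂ 0 * t)) := by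
      gcongr
      exact hP.abs_charcoal_le_of_dist_e₂_le hv hu hdist t ht
    have hsq : 0 ≤ m * (u t 0 - P.U₁) ^ 2 := by positivity
    linarith [hderiv (u t) (hdist t ht)]

theorem stableWithin_e₂ (hP : P.Admissible) (hv : 0 < v) (heq : P.MicrobeEq s v) :
    StableWithin (P.field s) S (P.e₂ v) (P.radius v) := by
  obtain ⟨C, _, hlyapunov⟩ := hP.exists_lyapunov_le (s := s) (S := S) hv
  intro ε hε
  obtain ⟨η, hη, hcoercive⟩ := hP.exists_forall_lyapunov_lt_imp hv heq hε
  have hcont : Continuous fun x : Fin 3 → ℝ => P.lyapunov s v x + C * |x 2| :=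
    (hP.continuous_lyapunov hv).add (continuous_const.mul (continuous_apply 2).abs)
  have hsmall : ∀ᶠ x in 𝓝 (P.e₂ v), P.lyapunov s v x + C * |x 2| < η := by
    refine hcont.continuousAt.eventually_lt_const ?_
    beta_reduce
    rw [lyapunov_e₂, show P.e₂ v 2 = 0 from rfl, abs_zero, mul_zero, add_zero]
    exact hη
  obtain ⟨r, hr, hball⟩ := Metric.eventually_nhds_iff.1 hsmall
  refine ⟨min r ε, lt_min hr hε, fun T _ u hu hdist h0 t ht => ?_⟩
  obtain ⟨horganic, hmicrobes⟩ := hcoercive (u t)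
    ((hlyapunov T u hu hdist t ht).trans_lt (hball (h0.trans_le (min_le_left _ _))))
  have hcharcoal : |u t 2| ≤ |u 0 2| := hP.abs_charcoal_le hu
    (fun t ht => (half_pos hv).le.trans (half_le_of_dist_e₂_le (hdist t ht)).2) t ht
  exact dist_e₂_lt_iff.2 ⟨horganic, hmicrobes,
    hcharcoal.trans_lt (dist_e₂_lt_iff.1 (h0.trans_le (min_le_right _ _))).2.2⟩

/-- The left-hand side is the derivative of `N * lyapunov + (u₁ - U₁) (u₂ - v)` along solutions. -/
theorem exists_lyapunovDeriv_add_cross_le (hP : P.Admissible) (hv : 0 < v)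
    (heq : P.MicrobeEq s v) (hr : 0 < r) :
    ∃ N, ∃ h > 0, ∃ C ≥ 0, ∀ u, dist u (P.e₂ v) ≤ P.radius v →
      r ≤ |u 0 - P.U₁| ∨ r ≤ |u 1 - v| →
      N * P.lyapunovDeriv s v u
        + (P.field s u 0 * (u 1 - v) + (u 0 - P.U₁) * P.field s u 1) ≤ -h + C * |u 2| := by
  have hzero := microbeEq_iff.1 heq
  obtain ⟨m, hm, C, hC, hderiv⟩ := hP.exists_lyapunovDeriv_le (s := s) hv
  obtain ⟨C', hC', hcross⟩ := hP.exists_cross_le s v (P.radius v)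
  obtain ⟨h, hh, hsurplus⟩ := exists_mul_sub_le_neg_of_strictAnti hP.surplus_strictAnti hzero hr
  obtain ⟨M, hM, hquad⟩ := exists_neg_mul_sq_add_le (C := C') hh hr
  refine ⟨M / m, h / 2, half_pos hh, M / m * C + C', by positivity, fun u hu hfar => ?_⟩
  have hscaled : M / m * P.lyapunovDeriv s v u ≤
      -M * (u 0 - P.U₁) ^ 2 + M / m * C * |u 2| :=
    calc M / m * P.lyapunovDeriv s v u
        ≤ M / m * (-m * (u 0 - P.U₁) ^ 2 + C * |u 2|) := by gcongr; exact hderiv u hu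
      _ = -M * (u 0 - P.U₁) ^ 2 + M / m * C * |u 2| := by field_simp
  linarith [hcross u hu, hquad (u 0 - P.U₁) _
    (mul_sub_nonpos_of_antitone hP.surplus_strictAnti.antitone hzero (u 1))
    (hfar.imp_right (hsurplus (u 1)))]

theorem exists_dist_e₂_lt (hP : P.Admissible) (hv : 0 < v) (heq : P.MicrobeEq s v)
    {u : ℝ → Fin 3 → ℝ} (hu : IsSolutionOn (P.field s) S (Ici 0) u)
    (hdist : ∀ t ≥ 0, dist (u t) (P.e₂ v) ≤ P.radius v) (hr : 0 < r) :
    ∃ t ≥ 0, dist (u t) (P.e₂ v) < r := by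
  obtain ⟨N, h, hh, C, hC, hderiv⟩ := hP.exists_lyapunovDeriv_add_cross_le hv heq hr
  set q : (Fin 3 → ℝ) → ℝ := fun x => N * P.lyapunov s v x + (x 0 - P.U₁) * (x 1 - v)
  have hq : Continuous q := by
    have := hP.continuous_lyapunov (s := s) hv
    fun_prop
  obtain ⟨B, hB⟩ := (isCompact_closedBall (P.e₂ v) (P.radius v)).exists_bound_of_continuousOn
    hq.continuousOn
  obtain ⟨a, ha, hsmall⟩ := exists_forall_ge_mul_exp_lt ((C + 1) * |u 0 2|) (hP.k₂_pos 0)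
    (lt_min hr (half_pos hh))
  have hcharcoal : ∀ t ≥ a, (C + 1) * |u t 2| < min r (h / 2) := fun t ht => by
    refine lt_of_le_of_lt ?_ (hsmall t ht)
    rw [mul_assoc]
    gcongr
    exact hP.abs_charcoal_le_of_dist_e₂_le hv (hu.mono Icc_subset_Ici_self)
      (fun t ht => hdist t ht.1) t (right_mem_Icc.2 (ha.trans ht))
  have hqderiv : ∀ t ≥ a, HasDerivWithinAt (fun t => q (u t)) (N * P.lyapunovDeriv s v (u t)
      + (P.field s (u t) 0 * (u t 1 - v) + (u t 0 - P.U₁) * P.field s (u t) 1)) (Ici a) t :=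
    fun t ht => (((hP.hasDerivWithinAt_lyapunov hv hu (ha.trans ht)).const_mul N).add
      (((hu.hasDerivWithinAt_apply (ha.trans ht) 0).sub_const P.U₁).mul
        ((hu.hasDerivWithinAt_apply (ha.trans ht) 1).sub_const v))).mono (Ici_subset_Ici.2 ha)
  obtain ⟨t, ht, hlt⟩ := exists_lt_deriv_of_bddBelow (half_pos hh) hqderiv
    fun t ht => neg_le_of_abs_le (hB (u t) (hdist t (ha.trans ht)))
  refine ⟨t, ha.trans ht, ?_⟩
  obtain ⟨hr', hh'⟩ := lt_min_iff.1 (hcharcoal t ht)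
  have hC' : 0 ≤ C * |u t 2| := by positivity
  by_contra hfar
  have hfar' : r ≤ |u t 0 - P.U₁| ∨ r ≤ |u t 1 - v| := by
    by_contra! hnear
    exact hfar (dist_e₂_lt_iff.2 ⟨hnear.1, hnear.2, by linarith⟩)
  linarith [hderiv (u t) (hdist t (ha.trans ht)) hfar', abs_nonneg (u t 2)]

theorem asymptoticallyStable_univ_e₂ (hP : P.Admissible) (hs : P.threshold < s)
    (heq : P.MicrobeEq s v) : AsymptoticallyStable (P.field s) univ (P.e₂ v) := by
  have hv := (hP.microbeEq_pos_iff heq).2 hs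
  have hρ := hP.radius_pos hv
  exact ((hP.stableWithin_e₂ hv heq).lyapunovStable_univ hρ
    (hP.locallyLipschitz_field s)).asymptoticallyStable hρ
      fun _ hu hdist _ hr => hP.exists_dist_e₂_lt hv heq hu hdist hr

theorem asymptoticallyStable_octant_e₂ (hP : P.Admissible) (hs : P.threshold < s)
    (heq : P.MicrobeEq s v) : AsymptoticallyStable (P.field s) octant (P.e₂ v) :=
  (hP.asymptoticallyStable_univ_e₂ hs heq).of_univ
    fun _ hx => hP.exists_solution_octant (hP.threshold_pos.trans hs).le hx

theorem existsUnique_stable_equilibrium (hP : P.Admissible) (hs : 0 ≤ s) :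
    ∃! e, e ∈ equilibria (P.field s) octant ∧ LyapunovStable (P.field s) octant e := by
  rcases lt_trichotomy s P.threshold with h | rfl | h
  · rw [hP.equilibria_of_le hs h.le]
    exact ⟨P.e₁ s, ⟨rfl, (hP.asymptoticallyStable_octant_e₁ hs h).1⟩, fun e he => he.1⟩
  · rw [hP.equilibria_of_le hs le_rfl]
    exact ⟨P.e₁ P.threshold, ⟨rfl, hP.lyapunovStable_e₁_threshold⟩, fun e he => he.1⟩
  · obtain ⟨v, hv⟩ := hP.exists_microbeEq h.le
    rw [hP.equilibria_of_lt h hv]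
    refine ⟨P.e₂ v, ⟨Or.inr rfl, (hP.asymptoticallyStable_octant_e₂ h hv).1⟩, ?_⟩
    rintro e ⟨rfl | he, hstable⟩
    · exact absurd hstable (hP.unstable_e₁ h).not_lyapunovStable
    · exact he

end Admissible

end SoilModel

/-! ### Linearization -/

theorem hasFDerivAt_mul_of_continuousAt_of_eq_zero {E : Type*} [NormedAddCommGroup E]
    [NormedSpace ℝ E] {φ ψ : E → ℝ} {ψ' : E →L[ℝ] ℝ} {x : E} (hφ : ContinuousAt φ x)
    (hψ : HasFDerivAt ψ ψ' x) (h0 : ψ x = 0) :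
    HasFDerivAt (fun y => φ y * ψ y) (φ x • ψ') x := by
  have hconst : HasFDerivAt (fun y => φ x * ψ y) (φ x • ψ') x := hψ.const_mul (φ x)
  have hincrement : HasFDerivAt (fun y => (φ y - φ x) * ψ y) (0 : E →L[ℝ] ℝ) x := by
    have hψO : ψ =O[𝓝 x] fun y => y - x := by simpa only [h0, sub_zero] using hψ.isBigO_sub
    have hφo : (fun y => φ y - φ x) =o[𝓝 x] fun _ => (1 : ℝ) :=
      (Asymptotics.isLittleO_one_iff ℝ).2 (tendsto_sub_nhds_zero_iff.2 hφ)
    refine .of_isLittleO ?_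
    simpa only [h0, mul_zero, sub_zero, zero_apply] using
      ((hφo.mul_isBigO hψO.norm_right).congr_right fun _ => one_mul _).of_norm_right
  refine ((hconst.fun_add hincrement).congr_fderiv (add_zero _)).congr_of_eventuallyEq
    (.of_forall fun y => ?_)
  ring

theorem differentiableAt_and_jacobian_eq {n : ℕ} {f : (Fin n → ℝ) → (Fin n → ℝ)} {x : Fin n → ℝ}
    {M : Matrix (Fin n) (Fin n) ℝ} {L : Fin n → (Fin n → ℝ) →L[ℝ] ℝ}
    (h : ∀ i, HasFDerivAt (fun y => f y i) (L i) x) (hM : ∀ i w, L i w = (M.mulVec w) i) :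
    DifferentiableAt ℝ f x ∧ jacobian f x = M := by
  have hf : HasFDerivAt f (ContinuousLinearMap.pi L) x := hasFDerivAt_pi.2 h
  refine ⟨hf.differentiableAt, ?_⟩
  rw [jacobian, hf.fderiv, ← LinearMap.toMatrix'_toLin' M]
  exact congrArg _ (LinearMap.ext fun w => funext fun i => hM i w)

open Polynomial in
theorem complexEigenvalues_eq_of_charpoly {n : ℕ} {M : Matrix (Fin n) (Fin n) ℝ} {Λ : Multiset ℂ}
    (h : (M.map (algebraMap ℝ ℂ)).charpoly = (Λ.map fun z => X - C z).prod) :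
    complexEigenvalues M = Λ := by
  rw [complexEigenvalues, h, roots_multiset_prod_X_sub_C]

open Polynomial in
theorem complexEigenvalues_of_add_of_mul {a b c d p q k : ℝ} {z w : ℂ} (hadd : z + w = a + d)
    (hmul : z * w = a * d - b * c) :
    complexEigenvalues !![a, b, p; c, d, q; 0, 0, k] = {(k : ℂ), z, w} := by
  have hadd' : (C z + C w : ℂ[X]) = C (a : ℂ) + C (d : ℂ) := by rw [← C_add, hadd, C_add]
  have hmul' : (C z * C w : ℂ[X]) = C (a : ℂ) * C (d : ℂ) - C (b : ℂ) * C (c : ℂ) := by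
    rw [← C_mul, hmul, C_sub, C_mul, C_mul]
  have hfactor : (X - C (a : ℂ)) * (X - C (d : ℂ)) * (X - C (k : ℂ))
      - C (b : ℂ) * C (c : ℂ) * (X - C (k : ℂ)) = (X - C (k : ℂ)) * ((X - C z) * (X - C w)) := by
    linear_combination (X * (X - C (k : ℂ))) * hadd' - (X - C (k : ℂ)) * hmul'
  refine complexEigenvalues_eq_of_charpoly ?_
  simpa [Matrix.charpoly, Matrix.det_fin_three] using hfactor

theorem re_neg_of_sq_sub_mul_add_eq_zero {a b : ℝ} (ha : a < 0) (hb : 0 < b) {z : ℂ}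
    (hz : z ^ 2 - a * z + b = 0) : z.re < 0 := by
  have hre : z.re * z.re - z.im * z.im - a * z.re + b = 0 := by
    simpa [pow_two] using congrArg Complex.re hz
  have him : z.im * (2 * z.re - a) = 0 := by
    have : z.re * z.im + z.im * z.re - a * z.im = 0 := by
      simpa [pow_two] using congrArg Complex.im hz
    linear_combination this
  by_contra! hz_nonneg
  have hz_real : z.im = 0 := (mul_eq_zero.1 him).resolve_right (by linarith)
  rw [hz_real] at hre
  nlinarith [mul_nonneg hz_nonneg (neg_pos.2 ha).le]

namespace SoilModel

variable {P : SoilModel} {s v : ℝ} {x : Fin 3 → ℝ}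

/-- The rate at which microbes consume organic matter, up to the factors `δ` and `μ` with which it
enters the equations. -/
def consumption (P : SoilModel) (u : Fin 3 → ℝ) : ℝ := P.k₃ (u 2) * u 1 * u 0 ^ P.δ

theorem jacobian_field_of_hasFDerivAt_consumption (hk₁ : DifferentiableAt ℝ P.k₁ (x 1))
    (hk₂ : Continuous P.k₂) (hx : x 2 = 0) {L : (Fin 3 → ℝ) →L[ℝ] ℝ} {a b c : ℝ}
    (h : HasFDerivAt P.consumption L x) (hL : ∀ w, L w = a * w 0 + b * w 1 + c * w 2) :
    DifferentiableAt ℝ (P.field s) x ∧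
      jacobian (P.field s) x =
        !![-P.k₁ (x 1) - P.δ * a, -deriv P.k₁ (x 1) * x 0 - P.δ * b + P.η * P.k₄, -(P.δ * c);
           P.μ * a, P.μ * b - P.k₄, P.μ * c;
           0, 0, -P.k₂ (x 1)] := by
  have hcoord : ∀ i : Fin 3, HasFDerivAt (fun u : Fin 3 → ℝ => u i)
      (ContinuousLinearMap.proj (R := ℝ) i) x := fun i => hasFDerivAt_apply i x
  have hdecay := (hk₁.hasDerivAt.comp_hasFDerivAt x (hcoord 1)).fun_mul (hcoord 0)
  have hfield₀ : HasFDerivAt (fun u => P.field s u 0) _ x :=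
    (((hdecay.fun_neg.fun_sub (h.const_mul P.δ)).fun_add
      ((hcoord 1).const_mul (P.η * P.k₄))).add_const s).congr_of_eventuallyEq
      (.of_forall fun u => by simp only [field_zero, consumption, Function.comp_apply]; ring)
  have hfield₁ : HasFDerivAt (fun u => P.field s u 1) _ x :=
    ((h.const_mul P.μ).fun_sub ((hcoord 1).const_mul P.k₄)).congr_of_eventuallyEq
      (.of_forall fun u => by simp only [field_one, consumption]; ring)
  have hrate : Continuous fun u : Fin 3 → ℝ => -P.k₂ (u 1) := by fun_prop
  have hfield₂ : HasFDerivAt (fun u => P.field s u 2) _ x :=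
    hasFDerivAt_mul_of_continuousAt_of_eq_zero hrate.continuousAt (hcoord 2) hx
  refine differentiableAt_and_jacobian_eq (L := ![_, _, _])
    (fun | 0 => hfield₀ | 1 => hfield₁ | 2 => hfield₂) fun i w => ?_
  fin_cases i <;>
    simp only [Matrix.mulVec, dotProduct, Fin.sum_univ_three, Matrix.of_apply, Matrix.cons_val,
      Fin.zero_eta, Fin.mk_one, Fin.reduceFinMk, Function.comp_apply, add_apply, sub_apply,
      neg_apply, smul_apply, ContinuousLinearMap.proj_apply, smul_eq_mul, hL] <;>
    ring

theorem sqrtDiscr_sq (P : SoilModel) (v : ℝ) :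
    P.sqrtDiscr v ^ 2 = ((P.A₁ v ^ 2 / 4 + P.A₂ v * P.A₃ v : ℝ) : ℂ) := by
  rw [sqrtDiscr, one_div]
  exact_mod_cast Complex.cpow_nat_inv_pow _ two_ne_zero

namespace Admissible

theorem linearization_e₁ (hP : P.Admissible) (hk : DifferentiableAt ℝ P.k₁ 0) :
    DifferentiableAt ℝ (P.field s) (P.e₁ s) ∧
      jacobian (P.field s) (P.e₁ s) =
        !![-P.k₁ 0, -(deriv P.k₁ 0 / P.k₁ 0) * s - P.δ * P.k₃ 0 * (s / P.k₁ 0) ^ P.δ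
              + P.η * P.k₄, 0;
           0, P.criticalEigenvalue s, 0;
           0, 0, -P.k₂ 0] := by
  have hrate : Continuous fun u : Fin 3 → ℝ => P.k₃ (u 2) * u 0 ^ P.δ :=
    (hP.continuous_k₃.comp (continuous_apply 2)).mul
      ((continuous_apply 0).rpow_const fun _ => Or.inr hP.δ_pos.le)
  have hconsumption : HasFDerivAt P.consumption _ (P.e₁ s) :=
    (hasFDerivAt_mul_of_continuousAt_of_eq_zero hrate.continuousAt
      (hasFDerivAt_apply (𝕜 := ℝ) 1 (P.e₁ s)) rfl).congr_of_eventuallyEq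
      (.of_forall fun u => mul_right_comm _ _ _)
  refine (jacobian_field_of_hasFDerivAt_consumption (s := s) hk hP.continuous_k₂ rfl
    hconsumption (a := 0) (b := P.k₃ 0 * (s / P.k₁ 0) ^ P.δ) (c := 0) fun w => ?_).imp_right
    fun h => h.trans ?_
  · simp [e₁]
  simp only [e₁, Matrix.cons_val, criticalEigenvalue, mul_zero, sub_zero, neg_zero, mul_assoc,
    neg_mul, div_mul_eq_mul_div, mul_div_assoc]

theorem complexEigenvalues_jacobian_e₁ (hP : P.Admissible) (hk : DifferentiableAt ℝ P.k₁ 0) :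
    complexEigenvalues (jacobian (P.field s) (P.e₁ s)) =
      {((-P.k₁ 0 : ℝ) : ℂ), (P.criticalEigenvalue s : ℂ), ((-P.k₂ 0 : ℝ) : ℂ)} := by
  rw [(hP.linearization_e₁ hk).2, complexEigenvalues_of_add_of_mul (z := (-P.k₁ 0 : ℝ))
    (w := P.criticalEigenvalue s) rfl (by simp)]
  exact (Multiset.cons_swap _ _ _).trans (congrArg _ (Multiset.pair_comm _ _))

theorem linearization_e₂ (hP : P.Admissible) (hk₁ : DifferentiableAt ℝ P.k₁ v)
    (hk₃ : DifferentiableAt ℝ P.k₃ 0) :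
    DifferentiableAt ℝ (P.field s) (P.e₂ v) ∧
      jacobian (P.field s) (P.e₂ v) =
        !![P.A₁ v, P.A₂ v, -(P.δ / P.μ) * (deriv P.k₃ 0 / P.k₃ 0) * P.k₄ * v;
           P.A₃ v, 0, deriv P.k₃ 0 / P.k₃ 0 * P.k₄ * v;
           0, 0, -P.k₂ v] := by
  have hμ := hP.μ_pos.ne'
  have hk₃0 := (hP.k₃_pos 0).ne'
  have hcoord : ∀ i : Fin 3, HasFDerivAt (fun u : Fin 3 → ℝ => u i)
      (ContinuousLinearMap.proj (R := ℝ) i) (P.e₂ v) := fun i => hasFDerivAt_apply i _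
  have hcharcoalRate : HasFDerivAt (fun u : Fin 3 → ℝ => P.k₃ (u 2)) _ (P.e₂ v) :=
    HasDerivAt.comp_hasFDerivAt (h₂ := P.k₃) (P.e₂ v) hk₃.hasDerivAt (hcoord 2)
  have hpow : HasFDerivAt (fun u : Fin 3 → ℝ => u 0 ^ P.δ) _ (P.e₂ v) :=
    (hcoord 0).rpow_const (Or.inl hP.U₁_pos.ne')
  have hconsumption : HasFDerivAt P.consumption _ (P.e₂ v) :=
    (hcharcoalRate.fun_mul (hcoord 1)).fun_mul hpow
  have hU₁ : P.k₃ 0 * P.U₁ ^ P.δ = P.k₄ / P.μ := by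
    rw [eq_div_iff hP.μ_pos.ne', ← hP.mul_U₁_rpow]; ring
  refine (jacobian_field_of_hasFDerivAt_consumption (s := s) hk₁ hP.continuous_k₂ rfl
    hconsumption (a := P.k₃ 0 * v * (P.δ * P.U₁ ^ (P.δ - 1))) (b := P.k₃ 0 * P.U₁ ^ P.δ)
    (c := deriv P.k₃ 0 * v * P.U₁ ^ P.δ) fun w => ?_).imp_right fun h => h.trans ?_
  · simp only [e₂, Matrix.cons_val, add_apply, smul_apply, ContinuousLinearMap.proj_apply,
      smul_eq_mul]
    ring
  have hA₁₃ : -(P.δ * (deriv P.k₃ 0 * v * P.U₁ ^ P.δ)) =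
      -(P.δ / P.μ) * (deriv P.k₃ 0 / P.k₃ 0) * P.k₄ * v := by
    rw [← hP.mul_U₁_rpow]; field_simp
  have hA₂₃ : P.μ * (deriv P.k₃ 0 * v * P.U₁ ^ P.δ) = deriv P.k₃ 0 / P.k₃ 0 * P.k₄ * v := by
    rw [← hP.mul_U₁_rpow]; field_simp
  have hA₁ : -P.k₁ v - P.δ * (P.k₃ 0 * v * (P.δ * P.U₁ ^ (P.δ - 1))) = P.A₁ v := by rw [A₁]; ring
  have hA₂ : -deriv P.k₁ v * P.U₁ - P.δ * (P.k₄ / P.μ) + P.η * P.k₄ = P.A₂ v := by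
    rw [A₂]; field_simp; ring
  have hA₃ : P.μ * (P.k₃ 0 * v * (P.δ * P.U₁ ^ (P.δ - 1))) = P.A₃ v := by rw [A₃]; ring
  simp only [e₂, Matrix.cons_val, hU₁, hA₁, hA₂, hA₃, hA₁₃, hA₂₃, mul_div_cancel₀ _ hμ, sub_self]

theorem complexEigenvalues_jacobian_e₂ (hP : P.Admissible) (hk₁ : DifferentiableAt ℝ P.k₁ v)
    (hk₃ : DifferentiableAt ℝ P.k₃ 0) :
    complexEigenvalues (jacobian (P.field s) (P.e₂ v)) =
      {((-P.k₂ v : ℝ) : ℂ), (P.A₁ v : ℂ) / 2 + P.sqrtDiscr v,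
        (P.A₁ v : ℂ) / 2 - P.sqrtDiscr v} := by
  have hsq := P.sqrtDiscr_sq v
  push_cast at hsq
  rw [(hP.linearization_e₂ hk₁ hk₃).2]
  refine complexEigenvalues_of_add_of_mul ?_ ?_
  · push_cast
    ring
  · push_cast
    linear_combination -hsq

theorem A₁_neg (hP : P.Admissible) (hv : 0 < v) : P.A₁ v < 0 := by
  have hδ := hP.δ_pos
  have hk₃ := hP.k₃_pos 0
  have hU₁ := hP.U₁_pos
  have : 0 < P.δ ^ 2 * P.k₃ 0 * v * P.U₁ ^ (P.δ - 1) := by positivity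
  rw [A₁]
  linarith [hP.k₁_pos v]

theorem A₂_neg (hP : P.Admissible) (h : P.η * P.μ < P.δ ∨ deriv P.k₁ v ≠ 0) : P.A₂ v < 0 := by
  have hderiv : 0 ≤ deriv P.k₁ v := hP.k₁_strictMono.monotone.deriv_nonneg
  have hdecay := mul_nonneg hderiv hP.U₁_pos.le
  rw [A₂]
  rcases h with hloss | hderiv_ne
  · have := mul_pos (div_pos hP.k₄_pos hP.μ_pos) (sub_pos.2 hloss)
    linarith
  · have := mul_pos (hderiv.lt_of_ne' hderiv_ne) hP.U₁_pos
    linarith [hP.slope_nonneg]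

theorem A₃_pos (hP : P.Admissible) (hv : 0 < v) : 0 < P.A₃ v := by
  have hδ := hP.δ_pos
  have hμ := hP.μ_pos
  have hk₃ := hP.k₃_pos 0
  have hU₁ := hP.U₁_pos
  rw [A₃]
  positivity

theorem re_eigenvalues_neg (hP : P.Admissible) (hv : 0 < v)
    (h : P.η * P.μ < P.δ ∨ deriv P.k₁ v ≠ 0) :
    ∀ z ∈ ({((-P.k₂ v : ℝ) : ℂ), (P.A₁ v : ℂ) / 2 + P.sqrtDiscr v,
      (P.A₁ v : ℂ) / 2 - P.sqrtDiscr v} : Multiset ℂ), z.re < 0 := by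
  have hconst : 0 < -(P.A₂ v * P.A₃ v) :=
    neg_pos.2 (mul_neg_of_neg_of_pos (hP.A₂_neg h) (hP.A₃_pos hv))
  have hsq := P.sqrtDiscr_sq v
  push_cast at hsq
  intro z hz
  simp only [Multiset.insert_eq_cons, Multiset.mem_cons, Multiset.mem_singleton] at hz
  rcases hz with rfl | rfl | rfl
  · exact neg_lt_zero.2 (hP.k₂_pos v)
  all_goals
    refine re_neg_of_sq_sub_mul_add_eq_zero (hP.A₁_neg hv) hconst ?_
    push_cast
    linear_combination hsq

end Admissible

end SoilModel

end

theorem mainTheorem2 (P : SoilModel) (hP : P.Admissible) :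
    -- the threshold is a bifurcation point
    IsBifurcationPoint P.field octant (Set.Ici 0) P.threshold ∧
    ∀ s : ℝ, 0 ≤ s →
      -- equilibria up to the threshold
      (s ≤ P.threshold → equilibria (P.field s) octant = {P.e₁ s}) ∧
      -- stability of the first equilibrium, by the sign of the critical eigenvalue
      (s < P.threshold → P.criticalEigenvalue s < 0 ∧
        AsymptoticallyStable (P.field s) octant (P.e₁ s) ∧
        (0 < s → AsymptoticallyStable (P.field s) Set.univ (P.e₁ s))) ∧
      (P.threshold < s → 0 < P.criticalEigenvalue s ∧
        Unstable (P.field s) octant (P.e₁ s)) ∧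
      -- linearization at the first equilibrium
      (DifferentiableAt ℝ P.k₁ 0 →
        DifferentiableAt ℝ (P.field s) (P.e₁ s) ∧
        jacobian (P.field s) (P.e₁ s) =
          !![-P.k₁ 0, -(deriv P.k₁ 0 / P.k₁ 0) * s - P.δ * P.k₃ 0 * (s / P.k₁ 0) ^ P.δ
                + P.η * P.k₄, 0;
             0, P.criticalEigenvalue s, 0;
             0, 0, -P.k₂ 0] ∧
        complexEigenvalues (jacobian (P.field s) (P.e₁ s)) =
          {((-P.k₁ 0 : ℝ) : ℂ), (P.criticalEigenvalue s : ℂ), ((-P.k₂ 0 : ℝ) : ℂ)}) ∧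
      -- the second equilibrium, above the threshold
      (P.threshold < s →
        (∃! v, P.MicrobeEq s v) ∧
        ∀ v, P.MicrobeEq s v →
          0 < v ∧
          equilibria (P.field s) octant = {P.e₁ s, P.e₂ v} ∧
          AsymptoticallyStable (P.field s) octant (P.e₂ v) ∧
          AsymptoticallyStable (P.field s) Set.univ (P.e₂ v) ∧
          -- linearization at the second equilibrium
          (DifferentiableAt ℝ P.k₁ v → DifferentiableAt ℝ P.k₃ 0 →
            DifferentiableAt ℝ (P.field s) (P.e₂ v) ∧
            jacobian (P.field s) (P.e₂ v) =
              !![P.A₁ v, P.A₂ v, -(P.δ / P.μ) * (deriv P.k₃ 0 / P.k₃ 0) * P.k₄ * v;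
                 P.A₃ v, 0, deriv P.k₃ 0 / P.k₃ 0 * P.k₄ * v;
                 0, 0, -P.k₂ v] ∧
            complexEigenvalues (jacobian (P.field s) (P.e₂ v)) =
              {((-P.k₂ v : ℝ) : ℂ), (P.A₁ v : ℂ) / 2 + P.sqrtDiscr v,
                (P.A₁ v : ℂ) / 2 - P.sqrtDiscr v} ∧
            (P.η * P.μ < P.δ ∨ deriv P.k₁ v ≠ 0 →
              ∀ z ∈ complexEigenvalues (jacobian (P.field s) (P.e₂ v)), z.re < 0))) ∧
      -- exactly one equilibrium is stable
      (∃! e, e ∈ equilibria (P.field s) octant ∧ LyapunovStable (P.field s) octant e) := by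
  refine ⟨hP.isBifurcationPoint, fun s hs => ⟨hP.equilibria_of_le hs,
    fun hlt => ⟨hP.criticalEigenvalue_neg hs hlt, hP.asymptoticallyStable_octant_e₁ hs hlt,
      fun _ => hP.asymptoticallyStable_univ_e₁ hs hlt⟩,
    fun hlt => ⟨hP.criticalEigenvalue_pos hlt, hP.unstable_e₁ hlt⟩, fun hk₁ => ?_,
    fun hlt => ⟨hP.existsUnique_microbeEq hlt.le, fun v hv => ?_⟩,
    hP.existsUnique_stable_equilibrium hs⟩⟩
  · obtain ⟨hdiff, hjacobian⟩ := hP.linearization_e₁ hk₁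
    exact ⟨hdiff, hjacobian, hP.complexEigenvalues_jacobian_e₁ hk₁⟩
  · have hv_pos := (hP.microbeEq_pos_iff hv).2 hlt
    refine ⟨hv_pos, hP.equilibria_of_lt hlt hv, hP.asymptoticallyStable_octant_e₂ hlt hv,
      hP.asymptoticallyStable_univ_e₂ hlt hv, fun hk₁ hk₃ => ?_⟩
    obtain ⟨hdiff, hjacobian⟩ := hP.linearization_e₂ hk₁ hk₃
    have heigenvalues := hP.complexEigenvalues_jacobian_e₂ (s := s) hk₁ hk₃
    refine ⟨hdiff, hjacobian, heigenvalues, fun hdecay => ?_⟩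
    rw [heigenvalues]
    exact hP.re_eigenvalues_neg hv_pos hdecay
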